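/- There is an absolute constant $C>0$ such that the following holds. Let $H=\sum_{a=1}^{L}H_a$ be a $k$-local Hamiltonian on $n$ qubits: each $H_a$ is Hermitian and acts non-trivially on at most $k$ qubits. Assume that $H$ is stoquastic (each $H_a$ has real non-positive off-diagonal entries in the computational basis) and frustration free (every ground state of $H$ is a ground state of every $H_a$), that $\|H_a\|_{\mathrm{op}}\le J$ for every $a$, and that $H$ has energy gap at least $\Delta>0$ (every eigenvalue of $H$ other than the smallest one exceeds the smallest one by at least $\Delta$). Let $\Pi$ be the orthogonal projection onto the ground subspace of $H$, let $|+\rangle=2^{-n/2}\sum_{x\in\{0,1\}^n}|x\rangle$, and put $\eta=\sqrt{\langle +|\Pi|+\rangle}$. Then $\eta>0$ and $\log(\eta^{-1})\le \frac n2\log 2$. Let $|\psi_0\rangle=\frac1\eta\Pi|+\rangle$ and let $0<\epsilon<1$. Then there is a classical Hamiltonian $H_c$, a sum of $T$ real-valued terms on $n+m$ bits, such that 1. each term of $H_c$ depends on at most $2k$ bits, and each bit is acted on by at most $2$ terms; 2. the marginal on the first $n$ bits of the Gibbs distribution $p(x,z)=\frac1Z e^{-H_c(x,z)}$, $x\in\{0,1\}^n$,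 $z\in\{0,1\}^m$, is within total variation distance $\epsilon$ of the distribution $x\mapsto|\langle x|\psi_0\rangle|^2$ of the ground state; 3. the number of terms satisfies $T\le C\,L^3J\Delta^{-1}\log(\eta^{-1}\epsilon^{-1})$; 4. the number of hidden bits satisfies $m\le C\,kL^3J\Delta^{-1}\log(\eta^{-1}\epsilon^{-1})$; and if every qubit is acted on non-trivially by at least one term $H_a$ and $\epsilon\le\frac12$, then also the total number of bits satisfies $n+m\le C\,kL^3J\Delta^{-1}\log(\eta^{-1}\epsilon^{-1})$. -/

import Mathlib

noncomputable section

namespace StoqGibbs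

/-! ### Quantum Hamiltonians on `n` qubits -/

/-- The computational basis of `n` qubits (equivalently, configurations of `n` classical bits). -/
abbrev Config (V : Type) : Type := V → Bool

/-- The Hilbert space of `n` qubits. -/
abbrev Qubits (n : ℕ) : Type := EuclideanSpace ℂ (Config (Fin n))

/-- Operators on `n` qubits, as matrices in the computational basis. -/
abbrev Op (n : ℕ) : Type := Matrix (Config (Fin n)) (Config (Fin n)) ℂ

/-- The restriction of a configuration to a set of bits. -/
def restrict {V : Type} (S : Finset V) (x : Config V) : S → Bool := fun i => x i

/-- `A` acts as the identity on all qubits outside `S`: that is, `A = B ⊗ 1` with `B` an operator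
on the qubits in `S`. -/
def ActsOn {n : ℕ} (A : Op n) (S : Finset (Fin n)) : Prop :=
  ∃ B : Matrix (S → Bool) (S → Bool) ℂ, ∀ x y : Config (Fin n),
    ((∀ i, i ∉ S → x i = y i) → A x y = B (restrict S x) (restrict S y)) ∧
    ((∃ i, i ∉ S ∧ x i ≠ y i) → A x y = 0)

/-- `A` acts non-trivially on the qubit `i`. -/
def ActsNontriviallyAt {n : ℕ} (A : Op n) (i : Fin n) : Prop :=
  ¬ ActsOn A (Finset.univ.erase i)

/-- The terms `h a` are those of a `k`-local Hamiltonian: each is Hermitian and acts non-trivially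
on at most `k` qubits. -/
def IsLocalHamiltonian {n L : ℕ} (k : ℕ) (h : Fin L → Op n) : Prop :=
  ∀ a, (h a).IsHermitian ∧ ∃ S : Finset (Fin n), S.card ≤ k ∧ ActsOn (h a) S

/-- Each term has real non-positive off-diagonal entries in the computational basis. -/
def IsStoquastic {n L : ℕ} (h : Fin L → Op n) : Prop :=
  ∀ a, ∀ x y, x ≠ y → (h a x y).im = 0 ∧ (h a x y).re ≤ 0

/-- The energy levels (real eigenvalues) of `A`. -/
def energies {n : ℕ} (A : Op n) : Set ℝ :=
  {E | Module.End.HasEigenvalue (Matrix.toEuclideanLin A) (E : ℂ)}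

/-- The ground energy: the least eigenvalue. -/
def groundEnergy {n : ℕ} (A : Op n) : ℝ := sInf (energies A)

/-- The ground subspace: the eigenspace of the least eigenvalue. -/
def groundSpace {n : ℕ} (A : Op n) : Submodule ℂ (Qubits n) :=
  Module.End.eigenspace (Matrix.toEuclideanLin A) (groundEnergy A : ℂ)

/-- Every ground state of `∑ a, h a` is a ground state of each individual term. -/
def IsFrustrationFree {n L : ℕ} (h : Fin L → Op n) : Prop :=
  ∀ a, groundSpace (∑ b, h b) ≤ groundSpace (h a)

/-- The energy gap above the ground energy is at least `Δ`. -/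
def HasGap {n : ℕ} (A : Op n) (Δ : ℝ) : Prop :=
  ∀ E ∈ energies A, E ≠ groundEnergy A → groundEnergy A + Δ ≤ E

/-- The operator norm induced by the Hilbert space norm. -/
def opNorm {n : ℕ} (A : Op n) : ℝ :=
  ‖Matrix.toEuclideanCLM (n := Config (Fin n)) (𝕜 := ℂ) A‖

/-- The uniform superposition `|+⟩`. -/
def plusState (n : ℕ) : Qubits n :=
  WithLp.toLp 2 fun _ => ((1 / Real.sqrt (2 ^ n) : ℝ) : ℂ)

/-- The vector `Π |+⟩`, with `Π` the orthogonal projection onto the ground subspace. -/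
def projectedPlus {n : ℕ} (A : Op n) : Qubits n :=
  (groundSpace A).starProjection (plusState n)

/-- The overlap `η = √⟨+|Π|+⟩`. -/
def overlap {n : ℕ} (A : Op n) : ℝ :=
  Real.sqrt (inner ℂ (plusState n) (projectedPlus A)).re

/-- The ground state `|ψ₀⟩ = η⁻¹ Π |+⟩`. -/
def groundState {n : ℕ} (A : Op n) : Qubits n :=
  (((overlap A)⁻¹ : ℝ) : ℂ) • projectedPlus A

/-- The distribution `x ↦ |⟨x|ψ₀⟩|²` of the ground state. -/
def groundDistribution {n : ℕ} (A : Op n) (x : Config (Fin n)) : ℝ :=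
  ‖groundState A x‖ ^ 2

/-! ### Classical Hamiltonians and Gibbs distributions -/

/-- A classical Hamiltonian on the bits `V`, given as a sum of `T` terms, the `t`-th of which is a
real function of the bits in `supp t`. -/
structure ClassicalHamiltonian (V : Type) (T : ℕ) where
  supp : Fin T → Finset V
  term : (t : Fin T) → (supp t → Bool) → ℝ

namespace ClassicalHamiltonian

variable {V : Type} {T : ℕ}

/-- The total energy of a configuration. -/
def energy (H : ClassicalHamiltonian V T) (x : Config V) : ℝ :=
  ∑ t, H.term t (restrict (H.supp t) x)

/-- Each term acts on at most `k` bits. -/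
def IsLocal (H : ClassicalHamiltonian V T) (k : ℕ) : Prop :=
  ∀ t, (H.supp t).card ≤ k

/-- Each bit is acted on by at most `d` terms. -/
def DegreeLE (H : ClassicalHamiltonian V T) (d : ℕ) : Prop :=
  ∀ v : V, {t : Fin T | v ∈ H.supp t}.ncard ≤ d

/-- The Gibbs distribution at temperature 1. -/
def gibbs [Fintype V] [DecidableEq V] (H : ClassicalHamiltonian V T) (x : Config V) : ℝ :=
  Real.exp (-H.energy x) / ∑ y : Config V, Real.exp (-H.energy y)

/-- The marginal of the Gibbs distribution on the visible bits `V`, the bits `W` being summed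
over. -/
def marginalGibbs {W : Type} [Fintype V] [DecidableEq V] [Fintype W] [DecidableEq W]
    (H : ClassicalHamiltonian (V ⊕ W) T) (x : Config V) : ℝ :=
  ∑ z : Config W, H.gibbs (Sum.elim x z)

end ClassicalHamiltonian

/-- Total variation distance. -/
def tvDist {α : Type} [Fintype α] (p q : α → ℝ) : ℝ := (1 / 2) * ∑ x, |p x - q x|

end StoqGibbs

end

/-!
Shift every term by its ground energy `E_a`. Then `A_a = (H_a - E_a) / 2J` satisfies `0 ≤ A_a ≤ 1`,
and by stoquasticity the matrix of `g_a = 1 - A_a` has non-negative entries in the computational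
basis (`exists_nonneg_gate`). By frustration freeness each `g_a` fixes the ground space of
`H = ∑ H_a`, and its product `G = ∏ g_a` over all terms is a strict contraction on the orthogonal
complement: if `‖Gψ‖` is close to `‖ψ‖`, then no single factor changes the vector much, hence `ψ`
is nearly annihilated by every `A_a`, which the gap forbids. Quantitatively,
`‖Gψ‖² ≤ (1 - Δ / 4JL²) ‖ψ‖²` (`sum_re_inner_le_sweep`, `norm_sq_sweep_iterate_le`). So `G ^ M |+⟩`
is within `η ε / 2` of `Π |+⟩ = η |ψ₀⟩` once `M` is of order `J L² Δ⁻¹ log (1 / ηε)`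
(`norm_sweep_iterate_plusState_sub_le`, `exists_rounds`), and then the normalised squares of its
amplitudes are within `ε` of the ground state distribution (`tvDist_normalized_le`).

The amplitude `f x` of `G ^ M |+⟩` is a sum over the intermediate configurations of products of gate
entries, that is, a partition function with one term per gate: a gate on the qubits `S` hides the
current bits in `S`, introduces new visible ones, and couples the two
(`IsPartitionFunction.applyGate`). Every bit then occurs in the gate that creates it and in the gate
that hides it, and a visible bit only in the former. Gluing two copies along the visible bits gives
`f x ^ 2` with all degrees still at most `2` (`IsPartitionFunction.sq`). Gate entries equal to zero
would have infinite energy; raising all entries by a small `δ > 0` repairs this, since the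
distribution depends continuously on `δ` (`exists_isPartitionFunction_tvDist_le`).

Two points concern the parameters. If `1 - η² ≤ ε²`, the uniform distribution, with no terms at all,
is good enough (`tvDist_uniform_le`); otherwise `η ε ≤ 1 / 2` and `H` has an excited state, so that
`log (1 / ηε) ≥ log 2` and `Δ ≤ 2LJ`, and rounding `M` up is paid for by the budget
(`pos_and_sq_le_budget`). That `η ≥ 2 ^ (-n/2)` holds because the entrywise absolute value of a
ground state of a stoquastic Hamiltonian is again a ground state (`absVec_mem_groundSpace`,
`one_div_sqrt_le_overlap`).
-/

namespace StoqGibbs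

open Matrix Finset Filter Topology

/-! ### Spectral facts about Hermitian operators -/

/-- The operator `A - E`, with `E` the ground energy of `A`. -/
noncomputable def shifted {n : ℕ} (A : Op n) : Qubits n →ₗ[ℂ] Qubits n :=
  Matrix.toEuclideanLin A - (groundEnergy A : ℂ) • LinearMap.id

theorem shifted_apply {n : ℕ} (A : Op n) (v : Qubits n) :
    shifted A v = Matrix.toEuclideanLin A v - (groundEnergy A : ℂ) • v := by
  simp [shifted]

theorem mem_groundSpace_iff {n : ℕ} (A : Op n) (v : Qubits n) :
    v ∈ groundSpace A ↔ shifted A v = 0 := by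
  rw [groundSpace, Module.End.mem_eigenspace_iff, shifted_apply, sub_eq_zero]

theorem shifted_isSymmetric {n : ℕ} {A : Op n} (hA : A.IsHermitian) :
    (shifted A).IsSymmetric := by
  apply LinearMap.IsSymmetric.sub
  · exact Matrix.isSymmetric_toEuclideanLin_iff.mpr hA
  · intro u v
    simp only [LinearMap.smul_apply, LinearMap.id_apply, inner_smul_left, inner_smul_right,
      Complex.conj_ofReal]

theorem toEuclideanLin_eigenvectorBasis {n : ℕ} {A : Op n} (hA : A.IsHermitian)
    (i : Config (Fin n)) :
    Matrix.toEuclideanLin A (hA.eigenvectorBasis i) =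
      (hA.eigenvalues i : ℂ) • hA.eigenvectorBasis i := by
  ext x
  have := congrFun (hA.mulVec_eigenvectorBasis i) x
  simpa [Matrix.toLpLin_apply] using this

theorem eigenvalues_mem_energies {n : ℕ} {A : Op n} (hA : A.IsHermitian)
    (i : Config (Fin n)) : hA.eigenvalues i ∈ energies A := by
  refine Module.End.hasEigenvalue_of_hasEigenvector (x := hA.eigenvectorBasis i) ⟨?_, ?_⟩
  · rw [Module.End.mem_eigenspace_iff]
    exact toEuclideanLin_eigenvectorBasis hA i
  · exact hA.eigenvectorBasis.orthonormal.ne_zero i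

theorem inner_eigenvectorBasis_toEuclideanLin {n : ℕ} {A : Op n} (hA : A.IsHermitian)
    (i : Config (Fin n)) (v : Qubits n) :
    inner ℂ (hA.eigenvectorBasis i) (Matrix.toEuclideanLin A v) =
      (hA.eigenvalues i : ℂ) * inner ℂ (hA.eigenvectorBasis i) v := by
  rw [← Matrix.isSymmetric_toEuclideanLin_iff.mpr hA, toEuclideanLin_eigenvectorBasis,
    inner_smul_left, Complex.conj_ofReal]

theorem energies_eq_range {n : ℕ} {A : Op n} (hA : A.IsHermitian) :
    energies A = Set.range hA.eigenvalues := by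
  ext E
  constructor
  · intro hE
    obtain ⟨v, hv⟩ := Module.End.HasEigenvalue.exists_hasEigenvector hE
    by_contra hne
    apply hv.2
    rw [← norm_eq_zero, ← sq_eq_zero_iff, ← hA.eigenvectorBasis.sum_sq_norm_inner_right]
    refine sum_eq_zero fun i _ => ?_
    have h1 := inner_eigenvectorBasis_toEuclideanLin hA i v
    rw [Module.End.mem_eigenspace_iff.mp hv.1, inner_smul_right] at h1
    have h2 : (E : ℂ) ≠ hA.eigenvalues i := by
      intro h
      exact hne ⟨i, (Complex.ofReal_injective h).symm⟩
    have h3 : ((E : ℂ) - hA.eigenvalues i) * inner ℂ (hA.eigenvectorBasis i) v = 0 := by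
      rw [sub_mul, h1, sub_self]
    simp [(mul_eq_zero.mp h3).resolve_left (sub_ne_zero.mpr h2)]
  · rintro ⟨i, rfl⟩
    exact eigenvalues_mem_energies hA i

theorem groundEnergy_mem {n : ℕ} {A : Op n} (hA : A.IsHermitian) :
    groundEnergy A ∈ energies A := by
  rw [groundEnergy, energies_eq_range hA]
  exact (Set.range_nonempty _).csInf_mem (Set.finite_range _)

theorem groundEnergy_le {n : ℕ} {A : Op n} (hA : A.IsHermitian) (i : Config (Fin n)) :
    groundEnergy A ≤ hA.eigenvalues i := by
  rw [groundEnergy, energies_eq_range hA]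
  exact csInf_le (Set.finite_range _).bddBelow ⟨i, rfl⟩

theorem abs_le_opNorm_of_mem_energies {n : ℕ} {A : Op n} {E : ℝ} (hE : E ∈ energies A) :
    |E| ≤ opNorm A := by
  obtain ⟨v, hv⟩ := Module.End.HasEigenvalue.exists_hasEigenvector hE
  have h1 := (Matrix.toEuclideanCLM (n := Config (Fin n)) (𝕜 := ℂ) A).le_opNorm v
  have h2 : Matrix.toEuclideanCLM (n := Config (Fin n)) (𝕜 := ℂ) A v = (E : ℂ) • v := by
    rw [← Module.End.mem_eigenspace_iff.mp hv.1]
    rfl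
  rw [h2, norm_smul, Complex.norm_real, Real.norm_eq_abs] at h1
  exact le_of_mul_le_mul_right h1 (norm_pos_iff.mpr hv.2)

theorem exists_groundState {n : ℕ} {A : Op n} (hA : A.IsHermitian) :
    ∃ v ∈ groundSpace A, v ≠ 0 := by
  obtain ⟨v, hv⟩ := Module.End.HasEigenvalue.exists_hasEigenvector (groundEnergy_mem hA)
  exact ⟨v, hv.1, hv.2⟩

theorem inner_eigenvectorBasis_shifted {n : ℕ} {A : Op n} (hA : A.IsHermitian)
    (i : Config (Fin n)) (v : Qubits n) :
    inner ℂ (hA.eigenvectorBasis i) (shifted A v) =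
      ((hA.eigenvalues i - groundEnergy A : ℝ) : ℂ) * inner ℂ (hA.eigenvectorBasis i) v := by
  rw [shifted_apply, inner_sub_right, inner_eigenvectorBasis_toEuclideanLin, inner_smul_right]
  push_cast
  ring

theorem re_inner_shifted {n : ℕ} {A : Op n} (hA : A.IsHermitian) (v : Qubits n) :
    (inner ℂ v (shifted A v)).re =
      ∑ i, (hA.eigenvalues i - groundEnergy A) * ‖inner ℂ (hA.eigenvectorBasis i) v‖ ^ 2 := by
  rw [← hA.eigenvectorBasis.sum_inner_mul_inner, Complex.re_sum]
  refine sum_congr rfl fun i _ => ?_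
  rw [inner_eigenvectorBasis_shifted, ← inner_conj_symm, mul_left_comm, Complex.re_ofReal_mul,
    ← Complex.normSq_eq_conj_mul_self, Complex.ofReal_re, Complex.normSq_eq_norm_sq]

theorem norm_sq_shifted {n : ℕ} {A : Op n} (hA : A.IsHermitian) (v : Qubits n) :
    ‖shifted A v‖ ^ 2 =
      ∑ i, (hA.eigenvalues i - groundEnergy A) ^ 2 *
        ‖inner ℂ (hA.eigenvectorBasis i) v‖ ^ 2 := by
  rw [← hA.eigenvectorBasis.sum_sq_norm_inner_right]
  refine sum_congr rfl fun i _ => ?_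
  rw [inner_eigenvectorBasis_shifted, norm_mul, Complex.norm_real, mul_pow, Real.norm_eq_abs,
    sq_abs]

theorem re_inner_shifted_nonneg {n : ℕ} {A : Op n} (hA : A.IsHermitian) (v : Qubits n) :
    0 ≤ (inner ℂ v (shifted A v)).re := by
  rw [re_inner_shifted hA]
  exact sum_nonneg fun i _ =>
    mul_nonneg (sub_nonneg.mpr (groundEnergy_le hA i)) (sq_nonneg _)

/-- A bound `J` on the operator norm bounds the spectrum of `A - E` by `2J`, so that
`(A - E)² ≤ 2J (A - E)`. -/
theorem norm_sq_shifted_le {n : ℕ} {A : Op n} (hA : A.IsHermitian) {J : ℝ} (hJ : opNorm A ≤ J)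
    (v : Qubits n) : ‖shifted A v‖ ^ 2 ≤ 2 * J * (inner ℂ v (shifted A v)).re := by
  rw [re_inner_shifted hA, norm_sq_shifted hA, mul_sum]
  refine sum_le_sum fun i _ => ?_
  have h1 := groundEnergy_le hA i
  have h2 := abs_le.mp ((abs_le_opNorm_of_mem_energies (eigenvalues_mem_energies hA i)).trans hJ)
  have h3 := abs_le.mp ((abs_le_opNorm_of_mem_energies (groundEnergy_mem hA)).trans hJ)
  rw [← mul_assoc, sq (_ - _)]
  gcongr
  · linarith

theorem mem_groundSpace_of_re_inner_le {n : ℕ} {A : Op n} (hA : A.IsHermitian) {v : Qubits n}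
    (h : (inner ℂ v (shifted A v)).re ≤ 0) : v ∈ groundSpace A := by
  rw [mem_groundSpace_iff, ← norm_eq_zero, ← sq_eq_zero_iff]
  have h0 := le_antisymm (norm_sq_shifted_le hA le_rfl v) (by
    rw [le_antisymm h (re_inner_shifted_nonneg hA v), mul_zero]; positivity)
  rw [h0, le_antisymm h (re_inner_shifted_nonneg hA v), mul_zero]

theorem gap_le_re_inner_shifted {n : ℕ} {A : Op n} (hA : A.IsHermitian) {Δ : ℝ}
    (hgap : HasGap A Δ) {v : Qubits n} (hv : v ∈ (groundSpace A)ᗮ) :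
    Δ * ‖v‖ ^ 2 ≤ (inner ℂ v (shifted A v)).re := by
  rw [re_inner_shifted hA, ← hA.eigenvectorBasis.sum_sq_norm_inner_right, mul_sum]
  refine sum_le_sum fun i _ => ?_
  by_cases hi : hA.eigenvalues i = groundEnergy A
  · have : inner ℂ (hA.eigenvectorBasis i) v = 0 := by
      apply hv
      rw [groundSpace, Module.End.mem_eigenspace_iff, ← hi]
      exact toEuclideanLin_eigenvectorBasis hA i
    simp [this]
  · have := hgap _ (eigenvalues_mem_energies hA i) hi
    gcongr
    linarith

/-- An operator with an energy gap `Δ` and a non-constant spectrum has norm at least `Δ / 2`. -/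
theorem gap_le_two_mul_opNorm {n : ℕ} {A : Op n} (hA : A.IsHermitian) {Δ : ℝ}
    (hgap : HasGap A Δ) (hne : groundSpace A ≠ ⊤) : Δ ≤ 2 * opNorm A := by
  have : ∃ i, hA.eigenvalues i ≠ groundEnergy A := by
    by_contra! hall
    apply hne
    rw [eq_top_iff]
    intro v _
    apply mem_groundSpace_of_re_inner_le hA
    rw [re_inner_shifted hA]
    simp [hall]
  obtain ⟨i, hi⟩ := this
  have h1 := hgap _ (eigenvalues_mem_energies hA i) hi
  have h2 := abs_le.mp (abs_le_opNorm_of_mem_energies (eigenvalues_mem_energies hA i))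
  have h3 := abs_le.mp (abs_le_opNorm_of_mem_energies (groundEnergy_mem hA))
  linarith

/-! ### Products of contractions -/

section Contraction

variable {E : Type*} [NormedAddCommGroup E] [InnerProductSpace ℂ E]

/-- The inequality `A² ≤ A`, for quadratic forms; for symmetric `A` it says that `0 ≤ A ≤ 1`. -/
def IsFirm (A : E →ₗ[ℂ] E) : Prop := ∀ v, ‖A v‖ ^ 2 ≤ (inner ℂ v (A v)).re

theorem IsFirm.re_inner_nonneg {A : E →ₗ[ℂ] E} (hA : IsFirm A) (v : E) :
    0 ≤ (inner ℂ v (A v)).re := (sq_nonneg _).trans (hA v)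

theorem IsFirm.norm_apply_le {A : E →ₗ[ℂ] E} (hA : IsFirm A) (v : E) : ‖A v‖ ≤ ‖v‖ := by
  have h1 := hA v
  have h2 : (inner ℂ v (A v)).re ≤ ‖v‖ * ‖A v‖ := re_inner_le_norm (𝕜 := ℂ) v (A v)
  by_contra! h
  nlinarith [norm_nonneg v]

theorem IsFirm.re_inner_le {A : E →ₗ[ℂ] E} (hA : IsFirm A) (v : E) :
    (inner ℂ v (A v)).re ≤ ‖v‖ ^ 2 := by
  have h2 : (inner ℂ v (A v)).re ≤ ‖v‖ * ‖A v‖ := re_inner_le_norm (𝕜 := ℂ) v (A v)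
  nlinarith [hA.norm_apply_le v, norm_nonneg v]

theorem IsFirm.re_inner_add_le {A : E →ₗ[ℂ] E} (hA : IsFirm A) (u v : E) :
    (inner ℂ (u + v) (A (u + v))).re ≤
      2 * (inner ℂ u (A u)).re + 2 * (inner ℂ v (A v)).re := by
  have h := hA.re_inner_nonneg (u - v)
  simp only [map_add, map_sub, inner_add_left, inner_add_right, inner_sub_left, inner_sub_right,
    Complex.add_re, Complex.sub_re] at h ⊢
  linarith

theorem IsFirm.norm_sq_sub_le {A : E →ₗ[ℂ] E} (hA : IsFirm A) (v : E) :
    ‖v - A v‖ ^ 2 ≤ ‖v‖ ^ 2 - (inner ℂ v (A v)).re := by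
  have h := @norm_sub_sq ℂ E _ _ _ v (A v)
  have h2 := hA v
  have h3 : RCLike.re (inner ℂ v (A v)) = (inner ℂ v (A v)).re := rfl
  rw [h3] at h
  linarith

/-- The product `∏ (1 - A)` over the list, applied to `v`; the head of the list acts last. -/
def sweep (l : List (E →ₗ[ℂ] E)) (v : E) : E := l.foldr (fun A w => w - A w) v

@[simp] theorem sweep_nil (v : E) : sweep [] v = v := rfl

@[simp] theorem sweep_cons (A : E →ₗ[ℂ] E) (l : List (E →ₗ[ℂ] E)) (v : E) :
    sweep (A :: l) v = sweep l v - A (sweep l v) := rfl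

theorem sweep_add (l : List (E →ₗ[ℂ] E)) (u v : E) :
    sweep l (u + v) = sweep l u + sweep l v := by
  induction l with
  | nil => rfl
  | cons A l ih => simp only [sweep_cons, ih, map_add]; abel

/-- A form of the detectability lemma: if a sweep hardly shortens `v`, then no factor changes the
vector much along the way, so `v` is close to being fixed by each factor. The first inequality is
what the induction needs for the second one. -/
theorem sum_re_inner_le_sweep (l : List (E →ₗ[ℂ] E)) (hl : ∀ A ∈ l, IsFirm A) (v : E) :
    ‖v - sweep l v‖ ^ 2 ≤ l.length * (‖v‖ ^ 2 - ‖sweep l v‖ ^ 2) ∧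
    (l.map fun A => (inner ℂ v (A v)).re).sum ≤
      2 * (l.length : ℝ) ^ 2 * (‖v‖ ^ 2 - ‖sweep l v‖ ^ 2) := by
  induction l with
  | nil => simp
  | cons A l ih =>
    obtain ⟨ih1, ih2⟩ := ih fun B hB => hl B (List.mem_cons_of_mem _ hB)
    have hA := hl A List.mem_cons_self
    set w := sweep l v with hw
    have hstep := hA.norm_sq_sub_le w
    have hq0 := hA.re_inner_nonneg w
    have hqn := hA w
    set q := (inner ℂ w (A w)).re with hq
    set δ := ‖v‖ ^ 2 - ‖w‖ ^ 2 with hδ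
    have hm : (0 : ℝ) ≤ l.length := Nat.cast_nonneg _
    have hδ' : δ + q ≤ ‖v‖ ^ 2 - ‖w - A w‖ ^ 2 := by linarith
    have hδ0 : 0 ≤ δ := by
      rcases l.eq_nil_or_concat with h | ⟨_, _, h⟩
      · simp [hδ, hw, h]
      · have : (0 : ℝ) < l.length := by rw [h]; simp; positivity
        by_contra! hneg
        nlinarith [sq_nonneg ‖v - w‖]
    simp only [sweep_cons, List.length_cons, List.map_cons, List.sum_cons, Nat.cast_add,
      Nat.cast_one, ← hw]
    constructor
    · have htri : ‖v - (w - A w)‖ ≤ ‖v - w‖ + ‖A w‖ := by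
        rw [show v - (w - A w) = (v - w) + A w by abel]
        exact norm_add_le _ _
      have h1 : ‖v - (w - A w)‖ ^ 2 ≤ (‖v - w‖ + ‖A w‖) ^ 2 := by gcongr
      have h2 : (‖v - w‖ + ‖A w‖) ^ 2 ≤ ((l.length : ℝ) + 1) * (δ + q) := by
        set a := ‖v - w‖
        set b := ‖A w‖
        set m : ℝ := (l.length : ℝ)
        -- `2ab ≤ δ + mb²`, because `(2ab)² ≤ 4 mδ b² ≤ (δ + mb²)²`
        have h3 : 2 * (a * b) ≤ δ + m * b ^ 2 := by
          refine (abs_le_of_sq_le_sq' ?_ (by positivity)).2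
          nlinarith [mul_le_mul_of_nonneg_right ih1 (sq_nonneg b), sq_nonneg (δ - m * b ^ 2)]
        nlinarith [mul_le_mul_of_nonneg_left hqn hm]
      exact h1.trans (h2.trans (by gcongr))
    · have h1 := hA.re_inner_add_le w (v - w)
      rw [add_sub_cancel] at h1
      have h2 := hA.re_inner_le (v - w)
      have h3 : 2 * ((l.length : ℝ) + 1) ^ 2 * (δ + q) ≤
          2 * ((l.length : ℝ) + 1) ^ 2 * (‖v‖ ^ 2 - ‖w - A w‖ ^ 2) := by gcongr
      nlinarith [mul_nonneg hm hδ0, mul_nonneg hm hq0, mul_nonneg (sq_nonneg (l.length : ℝ)) hq0]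

theorem sweep_mem_orthogonal (K : Submodule ℂ E) (l : List (E →ₗ[ℂ] E))
    (hsymm : ∀ A ∈ l, A.IsSymmetric) (hK : ∀ A ∈ l, ∀ u ∈ K, A u = 0) {v : E} (hv : v ∈ Kᗮ) :
    sweep l v ∈ Kᗮ := by
  induction l with
  | nil => exact hv
  | cons A l ih =>
    have hw := ih (fun B hB => hsymm B (List.mem_cons_of_mem _ hB))
      (fun B hB => hK B (List.mem_cons_of_mem _ hB))
    rw [sweep_cons]
    refine Kᗮ.sub_mem hw ?_
    intro u hu
    rw [← hsymm A List.mem_cons_self, hK A List.mem_cons_self u hu, inner_zero_left]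

theorem sweep_eq_self (K : Submodule ℂ E) (l : List (E →ₗ[ℂ] E))
    (hK : ∀ A ∈ l, ∀ u ∈ K, A u = 0) {u : E} (hu : u ∈ K) : sweep l u = u := by
  induction l with
  | nil => rfl
  | cons A l ih =>
    rw [sweep_cons, ih fun B hB => hK B (List.mem_cons_of_mem _ hB),
      hK A List.mem_cons_self u hu, sub_zero]

/-- Powers of a sweep converge exponentially to the projection onto the common kernel `K`. -/
theorem norm_sq_sweep_iterate_le (K : Submodule ℂ E) (l : List (E →ₗ[ℂ] E))
    (hl : ∀ A ∈ l, IsFirm A) (hsymm : ∀ A ∈ l, A.IsSymmetric)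
    (hK : ∀ A ∈ l, ∀ u ∈ K, A u = 0) {γ : ℝ}
    (hgap : ∀ v ∈ Kᗮ, 2 * (l.length : ℝ) ^ 2 * γ * ‖v‖ ^ 2 ≤
      (l.map fun A => (inner ℂ v (A v)).re).sum) (hlen : 0 < l.length)
    (M : ℕ) {v : E} (hv : v ∈ Kᗮ) :
    (sweep l)^[M] v ∈ Kᗮ ∧ ‖(sweep l)^[M] v‖ ^ 2 ≤ Real.exp (-γ * M) * ‖v‖ ^ 2 := by
  induction M with
  | zero => simpa using hv
  | succ M ih =>
    rw [Function.iterate_succ_apply']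
    obtain ⟨h1, h2⟩ := ih
    refine ⟨sweep_mem_orthogonal K l hsymm hK h1, ?_⟩
    set w := (sweep l)^[M] v
    have h3 := (hgap w h1).trans (sum_re_inner_le_sweep l hl w).2
    have hlen' : (0 : ℝ) < 2 * (l.length : ℝ) ^ 2 := by positivity
    have h4 : γ * ‖w‖ ^ 2 ≤ ‖w‖ ^ 2 - ‖sweep l w‖ ^ 2 := by
      rw [mul_assoc] at h3
      exact le_of_mul_le_mul_left h3 hlen'
    calc ‖sweep l w‖ ^ 2 ≤ (1 - γ) * ‖w‖ ^ 2 := by linarith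
      _ ≤ Real.exp (-γ) * ‖w‖ ^ 2 := by
        gcongr
        linarith [Real.add_one_le_exp (-γ)]
      _ ≤ Real.exp (-γ) * (Real.exp (-γ * M) * ‖v‖ ^ 2) := by gcongr
      _ = Real.exp (-γ * (M + 1 : ℕ)) * ‖v‖ ^ 2 := by
        rw [← mul_assoc, ← Real.exp_add]
        congr 2
        push_cast
        ring

theorem sweep_iterate_eq_self (K : Submodule ℂ E) (l : List (E →ₗ[ℂ] E))
    (hK : ∀ A ∈ l, ∀ u ∈ K, A u = 0) {u : E} (hu : u ∈ K) (M : ℕ) :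
    (sweep l)^[M] u = u :=
  Function.iterate_fixed (sweep_eq_self K l hK hu) M

theorem sweep_iterate_add (l : List (E →ₗ[ℂ] E)) (M : ℕ) (u v : E) :
    (sweep l)^[M] (u + v) = (sweep l)^[M] u + (sweep l)^[M] v := by
  induction M with
  | zero => rfl
  | succ M ih => simp only [Function.iterate_succ_apply', ih, sweep_add]

theorem sweep_smul (l : List (E →ₗ[ℂ] E)) (c : ℂ) (v : E) :
    sweep l (c • v) = c • sweep l v := by
  induction l with
  | nil => rfl
  | cons A l ih => simp only [sweep_cons, ih, map_smul, smul_sub]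

theorem sweep_iterate_smul (l : List (E →ₗ[ℂ] E)) (M : ℕ) (c : ℂ) (v : E) :
    (sweep l)^[M] (c • v) = c • (sweep l)^[M] v := by
  induction M with
  | zero => rfl
  | succ M ih => simp only [Function.iterate_succ_apply', ih, sweep_smul]

end Contraction

/-! ### Ground states of frustration-free stoquastic Hamiltonians -/

theorem isHermitian_sum {n L : ℕ} {h : Fin L → Op n} (hh : ∀ a, (h a).IsHermitian) :
    (∑ a, h a).IsHermitian := by
  rw [Matrix.IsHermitian, Matrix.conjTranspose_sum]
  exact sum_congr rfl fun a _ => hh a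

theorem groundEnergy_sum {n L : ℕ} {h : Fin L → Op n} (hh : ∀ a, (h a).IsHermitian)
    (hff : IsFrustrationFree h) : groundEnergy (∑ a, h a) = ∑ a, groundEnergy (h a) := by
  obtain ⟨v, hv, hv0⟩ := exists_groundState (isHermitian_sum hh)
  have h1 := Module.End.mem_eigenspace_iff.mp hv
  have h2 : Matrix.toEuclideanLin (∑ a, h a) v = (∑ a, (groundEnergy (h a) : ℂ)) • v := by
    rw [map_sum, LinearMap.sum_apply, Finset.sum_smul]
    exact sum_congr rfl fun a _ => Module.End.mem_eigenspace_iff.mp (hff a hv)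
  rw [h1] at h2
  have h3 := smul_left_injective ℂ hv0 h2
  exact_mod_cast h3

theorem shifted_sum {n L : ℕ} {h : Fin L → Op n} (hh : ∀ a, (h a).IsHermitian)
    (hff : IsFrustrationFree h) (v : Qubits n) :
    shifted (∑ a, h a) v = ∑ a, shifted (h a) v := by
  simp only [shifted_apply, groundEnergy_sum hh hff, Finset.sum_sub_distrib]
  rw [map_sum, LinearMap.sum_apply, Complex.ofReal_sum, Finset.sum_smul]

theorem re_inner_shifted_eq_sum_sub {n : ℕ} (A : Op n) (v : Qubits n) :
    (inner ℂ v (shifted A v)).re =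
      ∑ x, ∑ y, (star (v x) * A x y * v y).re - groundEnergy A * ‖v‖ ^ 2 := by
  rw [shifted_apply, inner_sub_right, Complex.sub_re, inner_smul_right, Complex.re_ofReal_mul]
  congr 1
  · simp only [PiLp.inner_apply, Complex.re_sum]
    refine sum_congr rfl fun x _ => ?_
    rw [← Complex.re_sum]
    simp only [Matrix.ofLp_toLpLin, Matrix.toLin'_apply, Matrix.mulVec, dotProduct, RCLike.inner_apply,
      Finset.sum_mul]
    congr 1
    refine sum_congr rfl fun y _ => ?_
    rw [starRingEnd_apply]
    ring
  · congr 1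
    exact (norm_sq_eq_re_inner (𝕜 := ℂ) v).symm

/-- The entrywise absolute value of a vector. -/
noncomputable def absVec {n : ℕ} (v : Qubits n) : Qubits n := WithLp.toLp 2 fun x => (‖v x‖ : ℂ)

@[simp] theorem absVec_apply {n : ℕ} (v : Qubits n) (x : Config (Fin n)) :
    absVec v x = (‖v x‖ : ℂ) := rfl

theorem norm_absVec {n : ℕ} (v : Qubits n) : ‖absVec v‖ = ‖v‖ := by
  simp [EuclideanSpace.norm_eq]

/-- Passing to absolute values does not increase the energy of a stoquastic Hamiltonian, so it
takes ground states to ground states. -/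
theorem absVec_mem_groundSpace {n : ℕ} {A : Op n} (hA : A.IsHermitian)
    (hst : ∀ x y, x ≠ y → (A x y).im = 0 ∧ (A x y).re ≤ 0) {v : Qubits n}
    (hv : v ∈ groundSpace A) : absVec v ∈ groundSpace A := by
  apply mem_groundSpace_of_re_inner_le hA
  have h0 : (inner ℂ v (shifted A v)).re = 0 := by
    rw [(mem_groundSpace_iff A v).mp hv, inner_zero_right, Complex.zero_re]
  rw [← h0, re_inner_shifted_eq_sum_sub, re_inner_shifted_eq_sum_sub, norm_absVec]
  refine sub_le_sub_right (sum_le_sum fun x _ => sum_le_sum fun y _ => ?_) _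
  by_cases hxy : x = y
  · subst hxy
    have h1 : star (v x) * A x x * v x = ((‖v x‖ ^ 2 : ℝ) : ℂ) * A x x := by
      rw [mul_right_comm, ← Complex.normSq_eq_norm_sq, Complex.normSq_eq_conj_mul_self]
      rfl
    have h2 : star (absVec v x) * A x x * absVec v x = ((‖v x‖ ^ 2 : ℝ) : ℂ) * A x x := by
      simp only [absVec_apply, Complex.star_def, Complex.conj_ofReal]
      push_cast
      ring
    rw [h1, h2]
  · obtain ⟨him, hre⟩ := hst x y hxy
    have hr : A x y = ((A x y).re : ℂ) := Complex.ext rfl (by simpa using him)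
    have h1 : star (v x) * A x y * v y = ((A x y).re : ℂ) * (star (v x) * v y) := by
      rw [← hr]
      ring
    have h2 : star (absVec v x) * A x y * absVec v y =
        ((A x y).re : ℂ) * ((‖v x‖ * ‖v y‖ : ℝ) : ℂ) := by
      rw [← hr]
      simp only [absVec_apply, Complex.star_def, Complex.conj_ofReal]
      push_cast
      ring
    rw [h1, h2, Complex.re_ofReal_mul, Complex.re_ofReal_mul, Complex.ofReal_re]
    apply mul_le_mul_of_nonpos_left _ hre
    refine (Complex.re_le_norm _).trans ?_
    rw [norm_mul, norm_star]

theorem norm_plusState (n : ℕ) : ‖plusState n‖ = 1 := by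
  rw [EuclideanSpace.norm_eq, Real.sqrt_eq_one]
  simp only [plusState, Complex.norm_real, Real.norm_eq_abs, sq_abs, div_pow, one_pow]
  rw [Real.sq_sqrt (by positivity), sum_const, card_univ]
  simp

theorem overlap_eq_norm {n : ℕ} (A : Op n) : overlap A = ‖projectedPlus A‖ := by
  rw [overlap, projectedPlus, ← inner_conj_symm, Complex.conj_re]
  have := Submodule.re_inner_starProjection_eq_normSq (K := groundSpace A) (plusState n)
  simp only [RCLike.re_to_complex] at this
  rw [this]
  exact Real.sqrt_sq (norm_nonneg _)

theorem overlap_le_one {n : ℕ} (A : Op n) : overlap A ≤ 1 := by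
  rw [overlap_eq_norm, ← norm_plusState n]
  exact Submodule.norm_starProjection_apply_le _ _

/-- A stoquastic Hamiltonian has a ground state with non-negative amplitudes, whose overlap with
`|+⟩` is at least `2^(-n/2)`. -/
theorem one_div_sqrt_le_overlap {n : ℕ} {A : Op n} (hA : A.IsHermitian)
    (hst : ∀ x y, x ≠ y → (A x y).im = 0 ∧ (A x y).re ≤ 0) :
    1 / Real.sqrt (2 ^ n) ≤ overlap A := by
  obtain ⟨v, hv, hv0⟩ := exists_groundState hA
  have hw := absVec_mem_groundSpace hA hst hv
  have hpos : 0 < ‖v‖ := norm_pos_iff.mpr hv0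
  have h1 : inner ℂ (projectedPlus A) (absVec v) = inner ℂ (plusState n) (absVec v) := by
    rw [projectedPlus, Submodule.inner_starProjection_left_eq_right,
      Submodule.starProjection_eq_self_iff.mpr hw]
  have h2 : inner ℂ (plusState n) (absVec v) =
      ((1 / Real.sqrt (2 ^ n) * ∑ x, ‖v x‖ : ℝ) : ℂ) := by
    simp only [PiLp.inner_apply, plusState, RCLike.inner_apply, absVec_apply]
    push_cast
    rw [mul_sum]
    refine sum_congr rfl fun x _ => ?_
    simp [mul_comm]
  have h3 : ‖v‖ ≤ ∑ x, ‖v x‖ := by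
    rw [EuclideanSpace.norm_eq]
    apply Real.sqrt_le_iff.mpr ⟨by positivity, ?_⟩
    exact Finset.sum_sq_le_sq_sum_of_nonneg fun _ _ => norm_nonneg _
  have h4 := norm_inner_le_norm (𝕜 := ℂ) (projectedPlus A) (absVec v)
  rw [h1, h2, Complex.norm_real, Real.norm_eq_abs, abs_of_nonneg (by positivity),
    ← overlap_eq_norm, norm_absVec] at h4
  have h5 : 1 / Real.sqrt (2 ^ n) * ‖v‖ ≤ overlap A * ‖v‖ :=
    (mul_le_mul_of_nonneg_left h3 (by positivity)).trans h4
  exact le_of_mul_le_mul_right h5 hpos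

theorem stoquastic_sum {n L : ℕ} {h : Fin L → Op n} (hst : IsStoquastic h)
    (x y : Config (Fin n)) (hxy : x ≠ y) :
    ((∑ a, h a) x y).im = 0 ∧ ((∑ a, h a) x y).re ≤ 0 := by
  rw [Matrix.sum_apply, Complex.im_sum, Complex.re_sum]
  exact ⟨sum_eq_zero fun a _ => (hst a x y hxy).1, sum_nonpos fun a _ => (hst a x y hxy).2⟩

theorem overlap_pos {n : ℕ} {A : Op n} (hA : A.IsHermitian)
    (hst : ∀ x y, x ≠ y → (A x y).im = 0 ∧ (A x y).re ≤ 0) : 0 < overlap A :=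
  lt_of_lt_of_le (by positivity) (one_div_sqrt_le_overlap hA hst)

theorem log_inv_overlap_le {n : ℕ} {A : Op n} (hA : A.IsHermitian)
    (hst : ∀ x y, x ≠ y → (A x y).im = 0 ∧ (A x y).re ≤ 0) :
    Real.log (overlap A)⁻¹ ≤ (n : ℝ) / 2 * Real.log 2 := by
  have h1 := one_div_sqrt_le_overlap hA hst
  have h2 := Real.log_le_log (by positivity) h1
  rw [one_div, Real.log_inv, Real.log_sqrt (by positivity), Real.log_pow] at h2
  rw [Real.log_inv]
  linarith

theorem norm_groundState {n : ℕ} {A : Op n} (hη : 0 < overlap A) : ‖groundState A‖ = 1 := by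
  rw [groundState, norm_smul, Complex.norm_real, Real.norm_eq_abs, abs_of_pos (inv_pos.mpr hη),
    ← overlap_eq_norm, inv_mul_cancel₀ hη.ne']

theorem re_inner_plusState_groundState {n : ℕ} {A : Op n} (hη : 0 < overlap A) :
    (inner ℂ (plusState n) (groundState A)).re = overlap A := by
  have h1 : (inner ℂ (plusState n) (projectedPlus A)).re = overlap A ^ 2 := by
    rw [overlap]
    refine (Real.sq_sqrt ?_).symm
    by_contra! h
    rw [overlap, Real.sqrt_eq_zero_of_nonpos h.le] at hη
    exact lt_irrefl _ hη
  rw [groundState, inner_smul_right, Complex.re_ofReal_mul, h1]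
  field_simp

/-! ### Total variation distance between measurement distributions -/

theorem tvDist_norm_sq_le {n : ℕ} (u v : Qubits n) :
    tvDist (fun x => ‖u x‖ ^ 2) (fun x => ‖v x‖ ^ 2) ≤ (1 / 2) * (‖u - v‖ * ‖u + v‖) := by
  rw [tvDist]
  gcongr
  have h1 : ∀ x, |‖u x‖ ^ 2 - ‖v x‖ ^ 2| ≤ ‖(u - v) x‖ * ‖(u + v) x‖ := by
    intro x
    have h2 : ((u - v) x * star ((u + v) x)).re = ‖u x‖ ^ 2 - ‖v x‖ ^ 2 := by
      simp only [PiLp.sub_apply, PiLp.add_apply, Complex.star_def, ← Complex.normSq_eq_norm_sq,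
        Complex.normSq_apply, Complex.mul_re, Complex.sub_re, Complex.sub_im, Complex.conj_re,
        Complex.conj_im, Complex.add_re, Complex.add_im]
      ring
    rw [← h2]
    refine (Complex.abs_re_le_norm _).trans ?_
    rw [norm_mul, norm_star]
  refine (sum_le_sum fun x _ => h1 x).trans ?_
  rw [EuclideanSpace.norm_eq, EuclideanSpace.norm_eq]
  exact Real.sum_mul_le_sqrt_mul_sqrt _ _ _

/-- Measuring `|+⟩` instead of the ground state costs at most the trace distance
`√(1 - η²)`. -/
theorem tvDist_uniform_le {n : ℕ} {A : Op n} (hη : 0 < overlap A) :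
    tvDist (fun _ => 1 / 2 ^ n) (groundDistribution A) ≤ Real.sqrt (1 - overlap A ^ 2) := by
  have h0 : (fun _ : Config (Fin n) => (1 : ℝ) / 2 ^ n) = fun x => ‖plusState n x‖ ^ 2 := by
    funext x
    simp only [plusState, Complex.norm_real, Real.norm_eq_abs, sq_abs, div_pow, one_pow]
    rw [Real.sq_sqrt (by positivity)]
  rw [h0]
  refine (tvDist_norm_sq_le _ _).trans ?_
  apply Real.le_sqrt_of_sq_le
  have h1 := @norm_sub_sq ℂ _ _ _ _ (plusState n) (groundState A)
  have h2 := @norm_add_sq ℂ _ _ _ _ (plusState n) (groundState A)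
  simp only [RCLike.re_to_complex, re_inner_plusState_groundState hη, norm_plusState,
    norm_groundState hη] at h1 h2
  rw [mul_pow, mul_pow, h1, h2]
  apply le_of_eq
  ring

/-- Normalising an approximation of `Π|+⟩` gives an approximation of the ground state. -/
theorem tvDist_normalized_le {n : ℕ} {A : Op n} (hη : 0 < overlap A) {w : Qubits n} (hw : w ≠ 0)
    {r : ℝ} (hr : ‖w - projectedPlus A‖ ≤ r) :
    tvDist (fun x => ‖w x‖ ^ 2 / ‖w‖ ^ 2) (groundDistribution A) ≤ 2 * r / overlap A := by
  have hwpos : 0 < ‖w‖ := norm_pos_iff.mpr hw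
  set u : Qubits n := ((‖w‖⁻¹ : ℝ) : ℂ) • w with hu
  have hu1 : ‖u‖ = 1 := by
    rw [hu, norm_smul, Complex.norm_real, Real.norm_eq_abs, abs_of_pos (inv_pos.mpr hwpos),
      inv_mul_cancel₀ hwpos.ne']
  have h0 : (fun x => ‖w x‖ ^ 2 / ‖w‖ ^ 2) = fun x => ‖u x‖ ^ 2 := by
    funext x
    rw [hu, PiLp.smul_apply, norm_smul, Complex.norm_real, Real.norm_eq_abs,
      abs_of_pos (inv_pos.mpr hwpos), mul_pow, inv_pow]
    ring
  rw [h0]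
  refine (tvDist_norm_sq_le u (groundState A)).trans ?_
  have hsum : ‖u + groundState A‖ ≤ 2 := by
    refine (norm_add_le _ _).trans ?_
    rw [hu1, norm_groundState hη]
    norm_num
  have hdiff : ‖u - groundState A‖ ≤ 2 * r / overlap A := by
    have hsplit : u - groundState A =
        ((‖w‖⁻¹ - (overlap A)⁻¹ : ℝ) : ℂ) • w +
          (((overlap A)⁻¹ : ℝ) : ℂ) • (w - projectedPlus A) := by
      rw [hu, groundState, smul_sub, Complex.ofReal_sub, sub_smul]
      abel
    rw [hsplit]
    refine (norm_add_le _ _).trans ?_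
    rw [norm_smul, norm_smul, Complex.norm_real, Complex.norm_real, Real.norm_eq_abs,
      Real.norm_eq_abs, abs_of_pos (inv_pos.mpr hη)]
    have h1 : |‖w‖⁻¹ - (overlap A)⁻¹| * ‖w‖ = (overlap A)⁻¹ * |‖w‖ - overlap A| := by
      have h3 : ‖w‖⁻¹ - (overlap A)⁻¹ = -((overlap A)⁻¹ * (‖w‖ - overlap A) * ‖w‖⁻¹) := by
        field_simp
        ring
      rw [h3, abs_neg, abs_mul, abs_mul, abs_of_pos (inv_pos.mpr hη),
        abs_of_pos (inv_pos.mpr hwpos), inv_mul_cancel_right₀ hwpos.ne']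
    have h2 : |‖w‖ - overlap A| ≤ r := by
      rw [overlap_eq_norm]
      exact (abs_norm_sub_norm_le _ _).trans hr
    rw [h1]
    calc _ ≤ (overlap A)⁻¹ * r + (overlap A)⁻¹ * r := by gcongr
      _ = 2 * r / overlap A := by ring
  nlinarith [norm_nonneg (u - groundState A), norm_nonneg (u + groundState A)]

/-! ### Local gates -/

/-- The configuration `x`, with the bits in `S` overwritten by `s`. -/
def updateOn {V : Type} [DecidableEq V] (S : Finset V) (x : Config V) (s : S → Bool) : Config V :=
  fun i => if h : i ∈ S then s ⟨i, h⟩ else x i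

section updateOn

variable {V : Type} [DecidableEq V] {S : Finset V}

@[simp] theorem restrict_updateOn (x : Config V) (s : S → Bool) :
    restrict S (updateOn S x s) = s := by
  funext i
  simp [restrict, updateOn]

theorem updateOn_apply_of_notMem {i : V} (hi : i ∉ S) (x : Config V) (s : S → Bool) :
    updateOn S x s i = x i := by
  simp [updateOn, hi]

theorem updateOn_injective (x : Config V) : Function.Injective (updateOn S x) := by
  intro s t hst
  rw [← restrict_updateOn x s, hst, restrict_updateOn]

theorem updateOn_restrict_of_agree {x y : Config V} (h : ∀ i, i ∉ S → x i = y i) :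
    updateOn S x (restrict S y) = y := by
  funext i
  by_cases hi : i ∈ S
  · simp [updateOn, restrict, hi]
  · rw [updateOn_apply_of_notMem hi, h i hi]

end updateOn

theorem ActsOn.mono {n : ℕ} {A : Op n} {S S' : Finset (Fin n)} (h : ActsOn A S) (hS : S ⊆ S') :
    ActsOn A S' := by
  obtain ⟨B, hB⟩ := h
  refine ⟨Matrix.of fun s t =>
      A (updateOn S' (fun _ => false) s) (updateOn S' (fun _ => false) t),
    fun x y => ⟨fun hxy => ?_, fun ⟨i, hi, hne⟩ => (hB x y).2 ⟨i, fun h => hi (hS h), hne⟩⟩⟩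
  have hval : ∀ (z : Config (Fin n)) (i : Fin n), i ∈ S' →
      updateOn S' (fun _ => false) (restrict S' z) i = z i := by
    intro z i hi
    simp [updateOn, restrict, hi]
  have hres : ∀ z : Config (Fin n),
      restrict S (updateOn S' (fun _ => false) (restrict S' z)) = restrict S z := by
    intro z
    funext i
    exact hval z i (hS i.2)
  rw [Matrix.of_apply]
  by_cases hag : ∀ i, i ∉ S → x i = y i
  · rw [(hB x y).1 hag, (hB (updateOn S' _ _) (updateOn S' _ _)).1, hres, hres]
    intro i hi
    by_cases hi' : i ∈ S'
    · rw [hval x i hi', hval y i hi', hag i hi]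
    · rw [updateOn_apply_of_notMem hi', updateOn_apply_of_notMem hi']
  · push Not at hag
    obtain ⟨i, hi, hne⟩ := hag
    have hi' : i ∈ S' := by
      by_contra h
      exact hne (hxy i h)
    rw [(hB x y).2 ⟨i, hi, hne⟩, (hB (updateOn S' _ _) (updateOn S' _ _)).2]
    exact ⟨i, hi, by rwa [hval x i hi', hval y i hi']⟩

theorem actsOn_smul_one {n : ℕ} (c : ℂ) (S : Finset (Fin n)) : ActsOn (c • (1 : Op n)) S := by
  refine ⟨c • 1, fun x y => ⟨fun hxy => ?_, fun ⟨i, _, hne⟩ => ?_⟩⟩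
  · have : x = y ↔ restrict S x = restrict S y := by
      refine ⟨fun h => h ▸ rfl, fun h => ?_⟩
      rw [← updateOn_restrict_of_agree hxy, ← h, updateOn_restrict_of_agree fun _ _ => rfl]
    simp [Matrix.one_apply, this]
  · have : x ≠ y := fun h => hne (h ▸ rfl)
    simp [this]

theorem eq_smul_one_of_groundSpace_eq_top {n : ℕ} {A : Op n} (h : groundSpace A = ⊤) :
    A = (groundEnergy A : ℂ) • (1 : Op n) := by
  apply Matrix.toEuclideanLin.injective
  ext1 v
  have h1 : v ∈ groundSpace A := h ▸ Submodule.mem_top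
  rw [Module.End.mem_eigenspace_iff.mp h1, map_smul, LinearMap.smul_apply]
  simp

/-- The action of `B ⊗ 1`, with `B` a real matrix on the bits in `S`, on a real vector. -/
def applyGate {V : Type} [DecidableEq V] (S : Finset V) (b : (S → Bool) → (S → Bool) → ℝ)
    (f : Config V → ℝ) (x : Config V) : ℝ :=
  ∑ s, b (restrict S x) s * f (updateOn S x s)

/-- A real vector, as a vector of the complex Hilbert space. -/
noncomputable def realVec {n : ℕ} (f : Config (Fin n) → ℝ) : Qubits n :=
  WithLp.toLp 2 fun x => (f x : ℂ)

theorem toEuclideanLin_apply_of_block {n : ℕ} {A : Op n} {S : Finset (Fin n)}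
    {B : Matrix (S → Bool) (S → Bool) ℂ}
    (hB : ∀ x y : Config (Fin n),
      ((∀ i, i ∉ S → x i = y i) → A x y = B (restrict S x) (restrict S y)) ∧
      ((∃ i, i ∉ S ∧ x i ≠ y i) → A x y = 0))
    (v : Qubits n) (x : Config (Fin n)) :
    Matrix.toEuclideanLin A v x = ∑ s, B (restrict S x) s * v (updateOn S x s) := by
  simp only [Matrix.ofLp_toLpLin, Matrix.toLin'_apply, Matrix.mulVec, dotProduct]
  symm
  refine Fintype.sum_of_injective (updateOn S x) (updateOn_injective x) _ _ ?_ ?_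
  · intro y hy
    rw [(hB x y).2, zero_mul]
    by_contra! h
    exact hy ⟨restrict S y, updateOn_restrict_of_agree h⟩
  · intro s
    rw [(hB x _).1 fun i hi => (updateOn_apply_of_notMem hi x s).symm, restrict_updateOn]

theorem isFirm_smul_shifted {n : ℕ} {A : Op n} (hA : A.IsHermitian) {J : ℝ} (hJ : opNorm A ≤ J)
    (hJ0 : 0 < J) : IsFirm (((1 / (2 * J) : ℝ) : ℂ) • shifted A) := by
  intro v
  rw [LinearMap.smul_apply, norm_smul, inner_smul_right, Complex.re_ofReal_mul, mul_pow,
    Complex.norm_real, Real.norm_eq_abs, sq_abs]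
  have h := norm_sq_shifted_le hA hJ v
  calc (1 / (2 * J)) ^ 2 * ‖shifted A v‖ ^ 2
      ≤ (1 / (2 * J)) ^ 2 * (2 * J * (inner ℂ v (shifted A v)).re) := by gcongr
    _ = 1 / (2 * J) * (inner ℂ v (shifted A v)).re := by field_simp

theorem re_diag_sub_groundEnergy_le {n : ℕ} {A : Op n} (hA : A.IsHermitian) {J : ℝ}
    (hJ : opNorm A ≤ J) (hJ0 : 0 < J) (x : Config (Fin n)) :
    1 / (2 * J) * ((A x x).re - groundEnergy A) ≤ 1 := by
  have h := (isFirm_smul_shifted hA hJ hJ0).re_inner_le (EuclideanSpace.single x 1)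
  rw [LinearMap.smul_apply, inner_smul_right, Complex.re_ofReal_mul, shifted_apply,
    EuclideanSpace.inner_single_left] at h
  simpa [Matrix.toLpLin_apply] using h

/-- For a stoquastic term `A`, the operator `1 - (A - E) / 2J` is a local gate with non-negative
entries: off the diagonal by stoquasticity, on it since `A - E ≤ 2J`. -/
theorem exists_nonneg_gate {n : ℕ} {A : Op n} (hA : A.IsHermitian)
    (hst : ∀ x y, x ≠ y → (A x y).im = 0 ∧ (A x y).re ≤ 0) {S : Finset (Fin n)}
    (hS : ActsOn A S) {J : ℝ} (hJ : opNorm A ≤ J) (hJ0 : 0 < J) :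
    ∃ b : (S → Bool) → (S → Bool) → ℝ, (∀ s t, 0 ≤ b s t) ∧
      ∀ f, realVec f - (((1 / (2 * J) : ℝ) : ℂ) • shifted A) (realVec f) =
        realVec (applyGate S b f) := by
  obtain ⟨B, hB⟩ := hS
  have hBA : ∀ s t, B s t = A (updateOn S (fun _ => false) s) (updateOn S (fun _ => false) t) := by
    intro s t
    rw [(hB _ _).1 fun i hi => by
      rw [updateOn_apply_of_notMem hi, updateOn_apply_of_notMem hi], restrict_updateOn,
      restrict_updateOn]
  have hreal : ∀ s t, B s t = ((B s t).re : ℂ) := by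
    intro s t
    refine Complex.ext rfl ?_
    rw [Complex.ofReal_im, hBA]
    by_cases hst' : s = t
    · subst hst'
      have := hA.apply (updateOn S (fun _ => false) s) (updateOn S (fun _ => false) s)
      exact Complex.conj_eq_iff_im.mp this
    · exact (hst _ _ fun h => hst' (updateOn_injective _ h)).1
  refine ⟨fun s t => (if s = t then 1 + 1 / (2 * J) * groundEnergy A else 0) -
    1 / (2 * J) * (B s t).re, fun s t => ?_, fun f => ?_⟩
  · beta_reduce
    by_cases hst' : s = t
    · subst hst'
      have := re_diag_sub_groundEnergy_le hA hJ hJ0 (updateOn S (fun _ => false) s)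
      rw [← hBA] at this
      rw [if_pos rfl]
      linarith
    · rw [if_neg hst', zero_sub, neg_nonneg]
      refine mul_nonpos_of_nonneg_of_nonpos (by positivity) ?_
      rw [hBA]
      exact (hst _ _ fun h => hst' (updateOn_injective _ h)).2
  · ext x
    have h1 := toEuclideanLin_apply_of_block hB (realVec f) x
    simp only [LinearMap.smul_apply, shifted_apply, PiLp.sub_apply, PiLp.smul_apply, h1,
      smul_eq_mul]
    simp only [realVec, applyGate, sub_mul, ite_mul, zero_mul, sum_sub_distrib, sum_ite_eq,
      mem_univ, if_true]
    rw [updateOn_restrict_of_agree fun _ _ => rfl]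
    have h2 : ∑ s, B (restrict S x) s * (f (updateOn S x s) : ℂ) =
        ((∑ s, (B (restrict S x) s).re * f (updateOn S x s) : ℝ) : ℂ) := by
      push_cast
      exact sum_congr rfl fun s _ => by rw [← hreal]
    simp only [mul_assoc, ← mul_sum]
    rw [h2]
    push_cast
    ring

/-! ### Functions computed by summing over hidden bits -/

/-- The function `f` is an unnormalised marginal `f x = ∑ z, exp (-E (x, z))`, where `E` is a sum
of at most `T` terms on the visible bits `Fin n` and at most `m` hidden bits; each term depends on
at most `2k` bits, a visible bit occurs in at most `d` terms, and a hidden one in at most `2`. The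
index types of hidden bits and terms are left arbitrary, so that the constructions below can use
sums of types. -/
def IsPartitionFunction (n k d T m : ℕ) (f : Config (Fin n) → ℝ) : Prop :=
  ∃ (W ι : Type) (_ : Fintype W) (_ : DecidableEq W) (_ : Fintype ι)
    (supp : ι → Finset (Fin n ⊕ W)) (term : ι → Config (Fin n ⊕ W) → ℝ),
    Fintype.card W ≤ m ∧ Fintype.card ι ≤ T ∧ (∀ t, (supp t).card ≤ 2 * k) ∧
    (∀ t x y, (∀ v ∈ supp t, x v = y v) → term t x = term t y) ∧
    (∀ i, {t | Sum.inl i ∈ supp t}.ncard ≤ d) ∧ (∀ w, {t | Sum.inr w ∈ supp t}.ncard ≤ 2) ∧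
    ∀ x, f x = ∑ z : Config W, Real.exp (-∑ t, term t (Sum.elim x z))

theorem isPartitionFunction_one (n k d : ℕ) : IsPartitionFunction n k d 0 0 1 := by
  refine ⟨Empty, Empty, inferInstance, inferInstance, inferInstance, fun _ => ∅, fun _ _ => 0,
    ?_⟩
  simp

/-- The embedding of the old bits into the new ones when a gate is applied on `S`: the visible bits
in `S` become hidden. -/
def hideBits {n : ℕ} (W : Type) (S : Finset (Fin n)) : Fin n ⊕ W ↪ Fin n ⊕ (W ⊕ S) where
  toFun := Sum.elim (fun i => if h : i ∈ S then Sum.inr (Sum.inr ⟨i, h⟩) else Sum.inl i)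
    fun w => Sum.inr (Sum.inl w)
  inj' := by
    rintro (i | w) (j | w') h
    · by_cases hi : i ∈ S <;> by_cases hj : j ∈ S <;> simp_all
    · by_cases hi : i ∈ S <;> simp_all
    · by_cases hj : j ∈ S <;> simp_all
    · simpa using h

theorem sum_config_sum {W W' : Type} [Fintype W] [DecidableEq W] [Fintype W'] [DecidableEq W']
    (F : Config (W ⊕ W') → ℝ) :
    ∑ z, F z = ∑ z : Config W, ∑ z' : Config W', F (Sum.elim z z') := by
  rw [← Fintype.sum_prod_type']
  exact Fintype.sum_equiv (Equiv.sumArrowEquivProdArrow W W' Bool) _ _ fun z => by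
    congr 1
    funext v
    rcases v with v | v <;> rfl

/-- Applying a positive gate on `S` adds one term, which couples the old bits in `S`, now hidden,
to the new ones. -/
theorem IsPartitionFunction.applyGate {n k T m : ℕ} {f : Config (Fin n) → ℝ}
    (hf : IsPartitionFunction n k 1 T m f) {S : Finset (Fin n)} (hS : S.card ≤ k)
    {b : (S → Bool) → (S → Bool) → ℝ} (hb : ∀ s t, 0 < b s t) :
    IsPartitionFunction n k 1 (T + 1) (m + k) (applyGate S b f) := by
  obtain ⟨W, ι, _, _, _, supp, term, hW, hι, hloc, hdep, hvis, hhid, hsum⟩ := hf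
  have hinl : ∀ i (h : i ∈ S), hideBits W S (Sum.inl i) = Sum.inr (Sum.inr ⟨i, h⟩) :=
    fun i h => dif_pos h
  have hinl' : ∀ i, i ∉ S → hideBits W S (Sum.inl i) = Sum.inl i := fun i h => dif_neg h
  have hinr : ∀ w, hideBits W S (Sum.inr w) = Sum.inr (Sum.inl w) := fun w => rfl
  let newSupp : Finset (Fin n ⊕ (W ⊕ S)) :=
    S.map Function.Embedding.inl ∪
      (univ : Finset S).map (Function.Embedding.inr.trans Function.Embedding.inr)
  let supp' : Option ι → Finset (Fin n ⊕ (W ⊕ S)) := fun t =>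
    t.elim newSupp fun t => (supp t).map (hideBits W S)
  let term' : Option ι → Config (Fin n ⊕ (W ⊕ S)) → ℝ := fun t y =>
    t.elim (-Real.log (b (fun i => y (Sum.inl i)) fun s => y (Sum.inr (Sum.inr s))))
      fun t => term t (y ∘ hideBits W S)
  have hmem : ∀ v t, hideBits W S v ∈ supp' (some t) ↔ v ∈ supp t := fun v t =>
    Finset.mem_map' (hideBits W S)
  refine ⟨W ⊕ S, Option ι, inferInstance, inferInstance, inferInstance, supp', term',
    ?_, ?_, ?_, ?_, ?_, ?_, ?_⟩
  · rw [Fintype.card_sum, Fintype.card_coe]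
    omega
  · rw [Fintype.card_option]
    omega
  · rintro (_ | t)
    · refine (card_union_le _ _).trans ?_
      rw [card_map, card_map, card_univ, Fintype.card_coe]
      omega
    · exact (card_map _).trans_le (hloc t)
  · rintro (_ | t) x y hxy
    · have h1 : (fun i : S => x (Sum.inl i)) = fun i : S => y (Sum.inl i) := by
        funext i
        apply hxy
        simp [supp', newSupp]
      have h2 : (fun s : S => x (Sum.inr (Sum.inr s))) = fun s => y (Sum.inr (Sum.inr s)) := by
        funext i
        apply hxy
        simp [supp', newSupp]
      simp only [term', Option.elim, h1, h2]
    · exact hdep t _ _ fun v hv => hxy _ ((hmem v t).mpr hv)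
  · intro i
    by_cases hi : i ∈ S
    · have : {t | Sum.inl i ∈ supp' t} ⊆ {none} := by
        rintro (_ | t) ht
        · rfl
        · exfalso
          obtain ⟨v, _, hv⟩ := Finset.mem_map.mp ht
          rcases v with j | w
          · by_cases hj : j ∈ S
            · rw [hinl j hj] at hv
              cases hv
            · rw [hinl' j hj] at hv
              exact hj (Sum.inl_injective hv ▸ hi)
          · cases hv
      exact (Set.ncard_le_ncard this (Set.toFinite _)).trans (Set.ncard_singleton _).le
    · have : {t | Sum.inl i ∈ supp' t} ⊆ some '' {t | Sum.inl i ∈ supp t} := by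
        rintro (_ | t) ht
        · simp [supp', newSupp, hi] at ht
        · refine ⟨t, ?_, rfl⟩
          rw [Set.mem_ofPred_eq, ← hinl' i hi] at ht
          exact (hmem _ t).mp ht
      exact (Set.ncard_le_ncard this (Set.toFinite _)).trans
        ((Set.ncard_image_le (Set.toFinite _)).trans (hvis i))
  · rintro (w | s)
    · have : {t | Sum.inr (Sum.inl w) ∈ supp' t} ⊆ some '' {t | Sum.inr w ∈ supp t} := by
        rintro (_ | t) ht
        · simp [supp', newSupp] at ht
        · refine ⟨t, ?_, rfl⟩
          rw [Set.mem_ofPred_eq, ← hinr w] at ht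
          exact (hmem _ t).mp ht
      exact (Set.ncard_le_ncard this (Set.toFinite _)).trans
        ((Set.ncard_image_le (Set.toFinite _)).trans (hhid w))
    · have : {t | Sum.inr (Sum.inr s) ∈ supp' t} ⊆
          insert none (some '' {t | Sum.inl s.1 ∈ supp t}) := by
        rintro (_ | t) ht
        · exact Set.mem_insert _ _
        · refine Set.mem_insert_of_mem _ ⟨t, ?_, rfl⟩
          rw [Set.mem_ofPred_eq, ← hinl s.1 s.2] at ht
          exact (hmem _ t).mp ht
      refine (Set.ncard_le_ncard this (Set.toFinite _)).trans ((Set.ncard_insert_le _ _).trans ?_)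
      exact Nat.succ_le_succ ((Set.ncard_image_le (Set.toFinite _)).trans (hvis s.1))
  · intro x
    have hcomp : ∀ (z : Config W) (s : S → Bool),
        (Sum.elim x (Sum.elim z s)) ∘ hideBits W S = Sum.elim (updateOn S x s) z := by
      intro z s
      funext v
      rcases v with i | w
      · by_cases hi : i ∈ S
        · simp [hinl i hi, updateOn, hi]
        · simp [hinl' i hi, updateOn, hi]
      · rfl
    rw [sum_config_sum, sum_comm, StoqGibbs.applyGate]
    refine sum_congr rfl fun s _ => ?_
    rw [hsum, mul_sum]
    refine sum_congr rfl fun z _ => ?_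
    rw [Fintype.sum_option, neg_add, Real.exp_add]
    simp only [term', Option.elim, hcomp, Sum.elim_inl, Sum.elim_inr, neg_neg]
    rw [Real.exp_log (hb _ _)]
    rfl

/-- Two copies of the hidden bits, attached to the same visible bits, compute the square. -/
theorem IsPartitionFunction.sq {n k T m : ℕ} {f : Config (Fin n) → ℝ}
    (hf : IsPartitionFunction n k 1 T m f) :
    IsPartitionFunction n k 2 (2 * T) (2 * m) (fun x => f x ^ 2) := by
  obtain ⟨W, ι, _, _, _, supp, term, hW, hι, hloc, hdep, hvis, hhid, hsum⟩ := hf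
  let el : Fin n ⊕ W ↪ Fin n ⊕ (W ⊕ W) :=
    (Function.Embedding.refl _).sumMap Function.Embedding.inl
  let er : Fin n ⊕ W ↪ Fin n ⊕ (W ⊕ W) :=
    (Function.Embedding.refl _).sumMap Function.Embedding.inr
  let supp' : ι ⊕ ι → Finset (Fin n ⊕ (W ⊕ W)) :=
    Sum.elim (fun t => (supp t).map el) fun t => (supp t).map er
  let term' : ι ⊕ ι → Config (Fin n ⊕ (W ⊕ W)) → ℝ := fun t y =>
    Sum.elim (fun t => term t (y ∘ el)) (fun t => term t (y ∘ er)) t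
  have hl : ∀ v t, el v ∈ supp' (Sum.inl t) ↔ v ∈ supp t := fun v t => Finset.mem_map' el
  have hr : ∀ v t, er v ∈ supp' (Sum.inr t) ↔ v ∈ supp t := fun v t => Finset.mem_map' er
  refine ⟨W ⊕ W, ι ⊕ ι, inferInstance, inferInstance, inferInstance, supp', term',
    ?_, ?_, ?_, ?_, ?_, ?_, ?_⟩
  · rw [Fintype.card_sum]
    omega
  · rw [Fintype.card_sum]
    omega
  · rintro (t | t)
    · exact (card_map _).trans_le (hloc t)
    · exact (card_map _).trans_le (hloc t)
  · rintro (t | t) x y hxy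
    · exact hdep t _ _ fun v hv => hxy _ ((hl v t).mpr hv)
    · exact hdep t _ _ fun v hv => hxy _ ((hr v t).mpr hv)
  · intro i
    have : {t | Sum.inl i ∈ supp' t} ⊆
        Sum.inl '' {t | Sum.inl i ∈ supp t} ∪ Sum.inr '' {t | Sum.inl i ∈ supp t} := by
      rintro (t | t) ht
      · exact Or.inl ⟨t, (hl (Sum.inl i) t).mp ht, rfl⟩
      · exact Or.inr ⟨t, (hr (Sum.inl i) t).mp ht, rfl⟩
    refine (Set.ncard_le_ncard this (Set.toFinite _)).trans ((Set.ncard_union_le _ _).trans ?_)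
    exact add_le_add ((Set.ncard_image_le (Set.toFinite _)).trans (hvis i))
      ((Set.ncard_image_le (Set.toFinite _)).trans (hvis i))
  · rintro (w | w)
    · have : {t | Sum.inr (Sum.inl w) ∈ supp' t} ⊆ Sum.inl '' {t | Sum.inr w ∈ supp t} := by
        rintro (t | t) ht
        · exact ⟨t, (hl (Sum.inr w) t).mp ht, rfl⟩
        · obtain ⟨v, _, hv⟩ := Finset.mem_map.mp ht
          rcases v with i | w <;> cases hv
      exact (Set.ncard_le_ncard this (Set.toFinite _)).trans
        ((Set.ncard_image_le (Set.toFinite _)).trans (hhid w))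
    · have : {t | Sum.inr (Sum.inr w) ∈ supp' t} ⊆ Sum.inr '' {t | Sum.inr w ∈ supp t} := by
        rintro (t | t) ht
        · obtain ⟨v, _, hv⟩ := Finset.mem_map.mp ht
          rcases v with i | w <;> cases hv
        · exact ⟨t, (hr (Sum.inr w) t).mp ht, rfl⟩
      exact (Set.ncard_le_ncard this (Set.toFinite _)).trans
        ((Set.ncard_image_le (Set.toFinite _)).trans (hhid w))
  · intro x
    have hcl : ∀ z z' : Config W, (Sum.elim x (Sum.elim z z')) ∘ el = Sum.elim x z := by
      intro z z'
      funext v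
      rcases v with i | w <;> rfl
    have hcr : ∀ z z' : Config W, (Sum.elim x (Sum.elim z z')) ∘ er = Sum.elim x z' := by
      intro z z'
      funext v
      rcases v with i | w <;> rfl
    beta_reduce
    rw [sum_config_sum, hsum, pow_two, sum_mul_sum]
    refine sum_congr rfl fun z _ => sum_congr rfl fun z' _ => ?_
    rw [Fintype.sum_sum_type, neg_add, Real.exp_add]
    simp only [term', Sum.elim_inl, Sum.elim_inr, hcl, hcr]

theorem IsPartitionFunction.exists_classicalHamiltonian {n k T m : ℕ} {f : Config (Fin n) → ℝ}
    (hf : IsPartitionFunction n k 2 T m f) :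
    ∃ (m' T' : ℕ) (Hc : ClassicalHamiltonian (Fin n ⊕ Fin m') T'), m' ≤ m ∧ T' ≤ T ∧
      Hc.IsLocal (2 * k) ∧ Hc.DegreeLE 2 ∧ ∀ x, Hc.marginalGibbs x = f x / ∑ y, f y := by
  obtain ⟨W, ι, _, _, _, supp, term, hW, hι, hloc, hdep, hvis, hhid, hsum⟩ := hf
  let eι := Fintype.equivFin ι
  let eW := Fintype.equivFin W
  let e : Fin n ⊕ W ≃ Fin n ⊕ Fin (Fintype.card W) := (Equiv.refl _).sumCongr eW
  let Hc : ClassicalHamiltonian (Fin n ⊕ Fin (Fintype.card W)) (Fintype.card ι) :=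
    { supp := fun t => (supp (eι.symm t)).map e.toEmbedding
      term := fun t y => term (eι.symm t) (updateOn _ (fun _ => false) y ∘ e) }
  have henergy : ∀ x, Hc.energy x = ∑ t, term t (x ∘ e) := by
    intro x
    rw [← eι.symm.sum_comp]
    refine sum_congr rfl fun t _ => hdep _ _ _ fun v hv => ?_
    have hv' : e v ∈ Hc.supp t := (Finset.mem_map' e.toEmbedding).mpr hv
    have := congrFun (restrict_updateOn (fun _ => false) (restrict (Hc.supp t) x)) ⟨e v, hv'⟩
    exact this
  have hweight : ∀ x, f x = ∑ z : Config (Fin (Fintype.card W)),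
      Real.exp (-Hc.energy (Sum.elim x z)) := by
    intro x
    rw [hsum]
    refine Fintype.sum_equiv (eW.arrowCongr (Equiv.refl Bool)) _ _ fun z => ?_
    rw [henergy]
    congr 2
    refine sum_congr rfl fun t _ => ?_
    congr 1
    funext v
    rcases v with i | w
    · rfl
    · simp [e, Equiv.arrowCongr]
  refine ⟨_, _, Hc, hW, hι, ?_, ?_, ?_⟩
  · intro t
    exact (card_map _).trans_le (hloc _)
  · intro v
    have hset : {t | v ∈ Hc.supp t} ⊆ eι '' {t | e.symm v ∈ supp t} := by
      intro t ht
      refine ⟨eι.symm t, ?_, eι.apply_symm_apply t⟩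
      obtain ⟨u, hu, rfl⟩ := Finset.mem_map.mp ht
      simpa using hu
    refine (Set.ncard_le_ncard hset (Set.toFinite _)).trans
      ((Set.ncard_image_le (Set.toFinite _)).trans ?_)
    rcases e.symm v with i | w
    · exact hvis i
    · exact hhid w
  · intro x
    simp only [ClassicalHamiltonian.marginalGibbs, ClassicalHamiltonian.gibbs]
    rw [← sum_div, ← hweight, sum_config_sum]
    simp only [← hweight]

/-! ### Circuits of local gates -/

/-- The successive application of the gates in a list; the head of the list acts last. -/
def applyGates {V ι : Type} [DecidableEq V] (l : List ι) (S : ι → Finset V)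
    (b : (a : ι) → (S a → Bool) → (S a → Bool) → ℝ) (f : Config V → ℝ) : Config V → ℝ :=
  l.foldr (fun a g => applyGate (S a) (b a) g) f

theorem IsPartitionFunction.applyGates {n k T m : ℕ} {ι : Type} {f : Config (Fin n) → ℝ}
    (hf : IsPartitionFunction n k 1 T m f) {S : ι → Finset (Fin n)} (hS : ∀ a, (S a).card ≤ k)
    {b : (a : ι) → (S a → Bool) → (S a → Bool) → ℝ} (hb : ∀ a s t, 0 < b a s t) (l : List ι) :
    IsPartitionFunction n k 1 (T + l.length) (m + l.length * k) (applyGates l S b f) := by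
  induction l with
  | nil => simpa [StoqGibbs.applyGates] using hf
  | cons a l ih =>
    have := ih.applyGate (hS a) (hb a)
    rwa [add_assoc, add_assoc, ← Nat.succ_mul] at this

theorem IsPartitionFunction.applyGates_iterate {n k : ℕ} {ι : Type}
    {S : ι → Finset (Fin n)} (hS : ∀ a, (S a).card ≤ k)
    {b : (a : ι) → (S a → Bool) → (S a → Bool) → ℝ} (hb : ∀ a s t, 0 < b a s t) (l : List ι)
    (M : ℕ) :
    IsPartitionFunction n k 1 (M * l.length) (M * (l.length * k))
      ((StoqGibbs.applyGates l S b)^[M] 1) := by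
  induction M with
  | zero => simpa using isPartitionFunction_one n k 1
  | succ M ih =>
    rw [Function.iterate_succ_apply', Nat.succ_mul, Nat.succ_mul]
    exact ih.applyGates hS hb l

theorem continuous_applyGates {V ι : Type} [DecidableEq V] (l : List ι) (S : ι → Finset V)
    (b : (a : ι) → (S a → Bool) → (S a → Bool) → ℝ) {F : ℝ → Config V → ℝ}
    (hF : ∀ x, Continuous fun δ => F δ x) (x : Config V) :
    Continuous fun δ => applyGates l S (fun a s t => b a s t + δ) (F δ) x := by
  induction l generalizing x with
  | nil => exact hF x
  | cons a l ih =>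
    exact continuous_finsetSum _ fun s _ => (continuous_const.add continuous_id).mul (ih _)

theorem continuous_applyGates_iterate {V ι : Type} [DecidableEq V] (l : List ι)
    (S : ι → Finset V) (b : (a : ι) → (S a → Bool) → (S a → Bool) → ℝ) (M : ℕ) (x : Config V) :
    Continuous fun δ => (applyGates l S (fun a s t => b a s t + δ))^[M] 1 x := by
  induction M generalizing x with
  | zero => exact continuous_const
  | succ M ih =>
    simp only [Function.iterate_succ_apply']
    exact continuous_applyGates l S b ih x

theorem sweep_map_realVec {n : ℕ} {ι : Type} (l : List ι) {S : ι → Finset (Fin n)}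
    {b : (a : ι) → (S a → Bool) → (S a → Bool) → ℝ} {A : ι → Qubits n →ₗ[ℂ] Qubits n}
    (hA : ∀ a f, realVec f - A a (realVec f) = realVec (applyGate (S a) (b a) f))
    (f : Config (Fin n) → ℝ) :
    sweep (l.map A) (realVec f) = realVec (applyGates l S b f) := by
  induction l with
  | nil => rfl
  | cons a l ih =>
    rw [List.map_cons, sweep_cons, ih, hA]
    rfl

theorem sweep_iterate_map_realVec {n : ℕ} {ι : Type} (l : List ι) {S : ι → Finset (Fin n)}
    {b : (a : ι) → (S a → Bool) → (S a → Bool) → ℝ} {A : ι → Qubits n →ₗ[ℂ] Qubits n}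
    (hA : ∀ a f, realVec f - A a (realVec f) = realVec (applyGate (S a) (b a) f)) (M : ℕ)
    (f : Config (Fin n) → ℝ) :
    (sweep (l.map A))^[M] (realVec f) = realVec ((applyGates l S b)^[M] f) := by
  induction M with
  | zero => rfl
  | succ M ih => rw [Function.iterate_succ_apply', ih, sweep_map_realVec l hA,
      Function.iterate_succ_apply']

theorem norm_sq_realVec {n : ℕ} (f : Config (Fin n) → ℝ) : ‖realVec f‖ ^ 2 = ∑ x, f x ^ 2 := by
  rw [EuclideanSpace.norm_sq_eq]
  simp [realVec]

theorem plusState_eq_smul (n : ℕ) :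
    plusState n = ((1 / Real.sqrt (2 ^ n) : ℝ) : ℂ) • realVec 1 := by
  ext x
  simp [plusState, realVec]

/-! ### The ground state distribution as a marginal -/

/-- `M` rounds of gates prepare the ground state from `|+⟩` up to an error
`exp (-Δ M / (8 J L²))`. -/
theorem norm_sweep_iterate_plusState_sub_le {n L : ℕ} {h : Fin L → Op n} {J Δ : ℝ}
    (hherm : ∀ a, (h a).IsHermitian) (hff : IsFrustrationFree h) (hJ : ∀ a, opNorm (h a) ≤ J)
    (hJ0 : 0 < J) (hL : 0 < L) (hgap : HasGap (∑ a, h a) Δ) (M : ℕ) :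
    ‖(sweep ((List.finRange L).map
        fun a => ((1 / (2 * J) : ℝ) : ℂ) • shifted (h a)))^[M] (plusState n) -
      projectedPlus (∑ a, h a)‖ ≤ Real.exp (-(Δ / (4 * J * (L : ℝ) ^ 2)) * M / 2) := by
  set H := ∑ a, h a with hH
  set A : Fin L → Qubits n →ₗ[ℂ] Qubits n :=
    fun a => ((1 / (2 * J) : ℝ) : ℂ) • shifted (h a) with hA
  set l := (List.finRange L).map A with hl
  have hlen : l.length = L := by simp [hl]
  have hmem : ∀ B ∈ l, ∃ a, A a = B := by
    intro B hB
    obtain ⟨a, _, ha⟩ := List.mem_map.mp hB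
    exact ⟨a, ha⟩
  have hfirm : ∀ B ∈ l, IsFirm B := by
    intro B hB
    obtain ⟨a, rfl⟩ := hmem B hB
    exact isFirm_smul_shifted (hherm a) (hJ a) hJ0
  have hsymm : ∀ B ∈ l, B.IsSymmetric := by
    intro B hB u v
    obtain ⟨a, rfl⟩ := hmem B hB
    simp only [hA, LinearMap.smul_apply, inner_smul_left, inner_smul_right, Complex.conj_ofReal,
      shifted_isSymmetric (hherm a) u v]
  have hker : ∀ B ∈ l, ∀ u ∈ groundSpace H, B u = 0 := by
    intro B hB u hu
    obtain ⟨a, rfl⟩ := hmem B hB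
    simp only [hA, LinearMap.smul_apply, (mem_groundSpace_iff _ _).mp (hff a hu), smul_zero]
  have hL' : (0 : ℝ) < L := Nat.cast_pos.mpr hL
  have hgap' : ∀ v ∈ (groundSpace H)ᗮ,
      2 * (l.length : ℝ) ^ 2 * (Δ / (4 * J * (L : ℝ) ^ 2)) * ‖v‖ ^ 2 ≤
        (l.map fun B => (inner ℂ v (B v)).re).sum := by
    intro v hv
    have h1 := gap_le_re_inner_shifted (isHermitian_sum hherm) hgap hv
    have h2 : (l.map fun B => (inner ℂ v (B v)).re).sum =
        1 / (2 * J) * (inner ℂ v (shifted H v)).re := by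
      rw [hl, List.map_map, ← List.ofFn_eq_map, List.sum_ofFn, shifted_sum hherm hff, inner_sum,
        Complex.re_sum, mul_sum]
      refine sum_congr rfl fun a _ => ?_
      simp only [Function.comp_apply, hA, LinearMap.smul_apply, inner_smul_right,
        Complex.re_ofReal_mul]
    rw [h2, hlen]
    calc 2 * (L : ℝ) ^ 2 * (Δ / (4 * J * (L : ℝ) ^ 2)) * ‖v‖ ^ 2
        = 1 / (2 * J) * (Δ * ‖v‖ ^ 2) := by
          field_simp
          ring
      _ ≤ _ := by gcongr
  have horth : plusState n - projectedPlus H ∈ (groundSpace H)ᗮ :=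
    Submodule.sub_starProjection_mem_orthogonal _
  have hdecomp : (sweep l)^[M] (plusState n) - projectedPlus H =
      (sweep l)^[M] (plusState n - projectedPlus H) := by
    conv_lhs => rw [← add_sub_cancel (projectedPlus H) (plusState n)]
    rw [sweep_iterate_add, sweep_iterate_eq_self (groundSpace H) l hker
      (u := projectedPlus H) (Submodule.starProjection_apply_mem _ _), add_sub_cancel_left]
  have hle : ‖plusState n - projectedPlus H‖ ≤ 1 := by
    have h1 := Submodule.norm_starProjection_apply_le (groundSpace H)ᗮ (plusState n)
    rwa [Submodule.starProjection_orthogonal_val, norm_plusState] at h1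
  rw [hdecomp]
  refine (abs_le_of_sq_le_sq' ?_ (Real.exp_pos _).le).2
  have h1 := (norm_sq_sweep_iterate_le (groundSpace H) l hfirm hsymm hker hgap'
    (hlen.symm ▸ hL) M horth).2
  refine h1.trans ?_
  rw [← Real.exp_nat_mul]
  calc _ ≤ Real.exp (-(Δ / (4 * J * (L : ℝ) ^ 2)) * M) * 1 := by
        gcongr
        exact pow_le_one₀ (norm_nonneg _) hle
    _ = _ := by
        rw [mul_one]
        congr 1
        push_cast
        ring

theorem exists_isPartitionFunction_tvDist_le {n k L : ℕ} {h : Fin L → Op n} {J Δ ε : ℝ}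
    (hloc : IsLocalHamiltonian k h) (hst : IsStoquastic h) (hff : IsFrustrationFree h)
    (hJ : ∀ a, opNorm (h a) ≤ J) (hJ0 : 0 < J) (hL : 0 < L) (hgap : HasGap (∑ a, h a) Δ)
    (hε : ε < 1) {M : ℕ}
    (hM : 2 * Real.exp (-(Δ / (4 * J * (L : ℝ) ^ 2)) * M / 2) < overlap (∑ a, h a) * ε) :
    ∃ f, IsPartitionFunction n k 2 (2 * (M * L)) (2 * (M * (L * k))) f ∧
      tvDist (fun x => f x / ∑ y, f y) (groundDistribution (∑ a, h a)) ≤ ε := by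
  have hherm : ∀ a, (h a).IsHermitian := fun a => (hloc a).1
  have hη := overlap_pos (isHermitian_sum hherm) (stoquastic_sum hst)
  have hclose := norm_sweep_iterate_plusState_sub_le hherm hff hJ hJ0 hL hgap M
  choose S hScard hSact using fun a => (hloc a).2
  choose b hb0 hb using fun a => exists_nonneg_gate (hherm a) (hst a) (hSact a) (hJ a) hJ0
  set r := Real.exp (-(Δ / (4 * J * (L : ℝ) ^ 2)) * M / 2)
  set η := overlap (∑ a, h a) with hηdef
  -- zero entries of the gates have no finite energy: all entries are raised by `δ`
  let F : ℝ → Config (Fin n) → ℝ := fun δ =>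
    (applyGates (List.finRange L) S fun a s t => b a s t + δ)^[M] 1
  have hF0 : F 0 = (applyGates (List.finRange L) S b)^[M] 1 := by simp only [F, add_zero]
  rw [plusState_eq_smul, sweep_iterate_smul, sweep_iterate_map_realVec _ hb, ← hF0] at hclose
  set c : ℝ := 1 / Real.sqrt (2 ^ n) with hc
  have hc0 : 0 < c := by positivity
  have hw : ((c : ℝ) : ℂ) • realVec (F 0) ≠ 0 := by
    intro h0
    rw [h0, zero_sub, norm_neg, ← overlap_eq_norm] at hclose
    nlinarith [Real.exp_pos (-(Δ / (4 * J * (L : ℝ) ^ 2)) * M / 2)]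
  have hsum0 : ∑ x, F 0 x ^ 2 ≠ 0 := by
    rw [← norm_sq_realVec]
    exact pow_ne_zero 2 (norm_ne_zero_iff.mpr (right_ne_zero_of_smul hw))
  have htv0 : tvDist (fun x => F 0 x ^ 2 / ∑ y, F 0 y ^ 2)
      (groundDistribution (∑ a, h a)) < ε := by
    have h1 := tvDist_normalized_le hη hw hclose
    have h2 : (fun x => ‖(((c : ℝ) : ℂ) • realVec (F 0)) x‖ ^ 2 /
        ‖((c : ℝ) : ℂ) • realVec (F 0)‖ ^ 2) = fun x => F 0 x ^ 2 / ∑ y, F 0 y ^ 2 := by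
      funext x
      rw [PiLp.smul_apply, norm_smul, norm_smul, mul_pow, mul_pow, norm_sq_realVec,
        mul_div_mul_left _ _ (pow_ne_zero 2 (norm_ne_zero_iff.mpr
          (Complex.ofReal_ne_zero.mpr hc0.ne')))]
      simp [realVec]
    rw [h2] at h1
    refine h1.trans_lt ?_
    rw [div_lt_iff₀ hη, mul_comm ε]
    exact hM
  have hcont : ∀ x, Continuous fun δ => F δ x := continuous_applyGates_iterate _ S b M
  have htv : ContinuousAt (fun δ => tvDist (fun x => F δ x ^ 2 / ∑ y, F δ y ^ 2)
      (groundDistribution (∑ a, h a))) 0 := by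
    unfold tvDist
    refine continuousAt_const.mul (tendsto_finsetSum _ fun x _ => ?_)
    refine ContinuousAt.abs (ContinuousAt.sub (ContinuousAt.div ?_ ?_ hsum0) continuousAt_const)
    · exact ((hcont x).pow 2).continuousAt
    · exact (continuous_finsetSum _ fun y _ => (hcont y).pow 2).continuousAt
  have hev : ∀ᶠ δ in 𝓝[>] (0 : ℝ), tvDist (fun x => F δ x ^ 2 / ∑ y, F δ y ^ 2)
      (groundDistribution (∑ a, h a)) < ε :=
    (htv.eventually_lt continuousAt_const htv0).filter_mono nhdsWithin_le_nhds
  obtain ⟨δ, hδtv, hδ⟩ := (hev.and self_mem_nhdsWithin).exists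
  refine ⟨fun x => F δ x ^ 2, ?_, hδtv.le⟩
  have hpos : ∀ a s t, 0 < b a s t + δ := fun a s t => add_pos_of_nonneg_of_pos (hb0 a s t) hδ
  have h1 := IsPartitionFunction.applyGates_iterate hScard hpos (List.finRange L) M
  rw [List.length_finRange] at h1
  exact h1.sq

/-! ### Parameter estimates -/

theorem opNorm_sum_le {n L : ℕ} {h : Fin L → Op n} {J : ℝ} (hJ : ∀ a, opNorm (h a) ≤ J) :
    opNorm (∑ a, h a) ≤ L * J := by
  rw [opNorm, map_sum]
  refine (norm_sum_le_of_le _ fun a _ => hJ a).trans ?_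
  simp

theorem card_qubits_le {n k L : ℕ} {h : Fin L → Op n} (hloc : IsLocalHamiltonian k h)
    (hact : ∀ i : Fin n, ∃ a, ActsNontriviallyAt (h a) i) : n ≤ L * k := by
  choose S hScard hSact using fun a => (hloc a).2
  have hcover : (univ : Finset (Fin n)) ⊆ univ.biUnion S := by
    intro i _
    obtain ⟨a, ha⟩ := hact i
    rw [mem_biUnion]
    refine ⟨a, mem_univ _, ?_⟩
    by_contra hi
    exact ha ((hSact a).mono fun j hj => mem_erase.mpr ⟨fun h => hi (h ▸ hj), mem_univ _⟩)
  calc n = (univ : Finset (Fin n)).card := by simp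
    _ ≤ (univ.biUnion S).card := card_le_card hcover
    _ ≤ (univ : Finset (Fin L)).card * k := card_biUnion_le_card_mul _ _ _ fun a _ => hScard a
    _ = L * k := by simp

theorem groundSpace_ne_top_of_actsNontriviallyAt {n L : ℕ} {h : Fin L → Op n}
    (hff : IsFrustrationFree h) {a : Fin L} {i : Fin n} (hact : ActsNontriviallyAt (h a) i) :
    groundSpace (∑ a, h a) ≠ ⊤ := by
  intro htop
  apply hact
  rw [eq_smul_one_of_groundSpace_eq_top (A := h a) (top_le_iff.mp (htop ▸ hff a))]
  exact actsOn_smul_one _ _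

theorem overlap_eq_one_of_groundSpace_eq_top {n : ℕ} {A : Op n} (h : groundSpace A = ⊤) :
    overlap A = 1 := by
  rw [overlap_eq_norm, projectedPlus, Submodule.starProjection_eq_self_iff.mpr, norm_plusState]
  rw [h]
  exact Submodule.mem_top

/-- The budget `L³ J Δ⁻¹ ℓ` is at least `L² / 4` for a Hamiltonian with an excited state, if
`ℓ ≥ log 2`. -/
theorem pos_and_sq_le_budget {n L : ℕ} {h : Fin L → Op n} {J Δ ℓ : ℝ}
    (hherm : ∀ a, (h a).IsHermitian) (hJ : ∀ a, opNorm (h a) ≤ J) (hΔ : 0 < Δ)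
    (hgap : HasGap (∑ a, h a) Δ) (hne : groundSpace (∑ a, h a) ≠ ⊤) (hℓ : Real.log 2 ≤ ℓ) :
    0 < L ∧ 0 < J ∧ (L : ℝ) ^ 2 ≤ 4 * ((L : ℝ) ^ 3 * J * Δ⁻¹ * ℓ) := by
  have h1 := (gap_le_two_mul_opNorm (isHermitian_sum hherm) hgap hne).trans
    (mul_le_mul_of_nonneg_left (opNorm_sum_le hJ) zero_le_two)
  have hLJ : 0 < (L : ℝ) * J := by linarith
  have hL : 0 < L := by
    rcases Nat.eq_zero_or_pos L with h0 | h0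
    · simp [h0] at hLJ
    · exact h0
  have hL' : (0 : ℝ) < L := Nat.cast_pos.mpr hL
  have hℓ' : 1 / 2 ≤ ℓ := by linarith [Real.log_two_gt_d9]
  refine ⟨hL, pos_of_mul_pos_right hLJ hL'.le, ?_⟩
  have h2 : 1 ≤ 2 * ((L : ℝ) * J) * Δ⁻¹ := by
    rw [← div_eq_mul_inv, le_div_iff₀ hΔ]
    linarith
  calc (L : ℝ) ^ 2 ≤ (L : ℝ) ^ 2 * ((2 * ((L : ℝ) * J) * Δ⁻¹) * (2 * ℓ)) :=
        le_mul_of_one_le_right (by positivity) (one_le_mul_of_one_le_of_one_le h2 (by linarith))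
    _ = _ := by ring

/-- The number of rounds: a multiple of `J L² Δ⁻¹ ℓ` suffices for an error below `η ε`. -/
theorem exists_rounds {L : ℕ} (hL : 0 < L) {J Δ ℓ q : ℝ} (hJ : 0 < J) (hΔ : 0 < Δ) (hq : 0 < q)
    (hℓ : ℓ = Real.log q⁻¹) (hℓ2 : Real.log 2 ≤ ℓ)
    (hbudget : (L : ℝ) ^ 2 ≤ 4 * ((L : ℝ) ^ 3 * J * Δ⁻¹ * ℓ)) :
    ∃ M : ℕ, 2 * Real.exp (-(Δ / (4 * J * (L : ℝ) ^ 2)) * M / 2) < q ∧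
      2 * ((M : ℝ) * L) ≤ 40 * ((L : ℝ) ^ 3 * J * Δ⁻¹ * ℓ) := by
  have hL' : (0 : ℝ) < L := Nat.cast_pos.mpr hL
  have hL1 : (1 : ℝ) ≤ L := Nat.one_le_cast.mpr hL
  have hlog2 : 0 < Real.log 2 := Real.log_pos one_lt_two
  set X := 8 * J * (L : ℝ) ^ 2 * Δ⁻¹ * (Real.log 2 + ℓ) with hX
  have hX0 : 0 ≤ X := by
    have : 0 ≤ Real.log 2 + ℓ := by linarith
    positivity
  refine ⟨⌊X⌋₊ + 1, ?_, ?_⟩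
  · have h1 : X < ((⌊X⌋₊ + 1 : ℕ) : ℝ) := by exact_mod_cast Nat.lt_floor_add_one X
    have h2 : -(Δ / (4 * J * (L : ℝ) ^ 2)) * ((⌊X⌋₊ + 1 : ℕ) : ℝ) / 2 <
        Real.log q - Real.log 2 := by
      have h3 : Δ / (4 * J * (L : ℝ) ^ 2) * X / 2 = Real.log 2 + ℓ := by
        rw [hX]
        field_simp
        ring
      have h4 : Δ / (4 * J * (L : ℝ) ^ 2) * X <
          Δ / (4 * J * (L : ℝ) ^ 2) * ((⌊X⌋₊ + 1 : ℕ) : ℝ) := by gcongr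
      rw [hℓ, Real.log_inv] at h3
      linarith
    have h5 := Real.exp_lt_exp.mpr h2
    rw [Real.exp_sub, Real.exp_log hq, Real.exp_log two_pos] at h5
    linarith
  · have h1 : ((⌊X⌋₊ + 1 : ℕ) : ℝ) ≤ X + 1 := by
      push_cast
      linarith [Nat.floor_le hX0]
    have h2 : X ≤ 16 * J * (L : ℝ) ^ 2 * Δ⁻¹ * ℓ := by
      calc X ≤ 8 * J * (L : ℝ) ^ 2 * Δ⁻¹ * (2 * ℓ) := by
            rw [hX]
            gcongr
            linarith
        _ = _ := by ring
    calc 2 * (((⌊X⌋₊ + 1 : ℕ) : ℝ) * L)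
        ≤ 2 * ((16 * J * (L : ℝ) ^ 2 * Δ⁻¹ * ℓ + 1) * L) := by
          gcongr
          linarith
      _ = 32 * ((L : ℝ) ^ 3 * J * Δ⁻¹ * ℓ) + 2 * L := by ring
      _ ≤ _ := by nlinarith

end StoqGibbs

open StoqGibbs in
theorem mainTheorem2 :
    ∃ C : ℝ, 0 < C ∧
      ∀ (n k L : ℕ) (h : Fin L → StoqGibbs.Op n) (J Δ ε : ℝ),
        StoqGibbs.IsLocalHamiltonian k h →
        StoqGibbs.IsStoquastic h →
        StoqGibbs.IsFrustrationFree h →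
        (∀ a, StoqGibbs.opNorm (h a) ≤ J) →
        0 < Δ →
        StoqGibbs.HasGap (∑ a, h a) Δ →
        0 < ε → ε < 1 →
        (0 < StoqGibbs.overlap (∑ a, h a) ∧
          Real.log (StoqGibbs.overlap (∑ a, h a))⁻¹ ≤ (n : ℝ) / 2 * Real.log 2) ∧
        ∃ (m T : ℕ) (Hc : StoqGibbs.ClassicalHamiltonian (Fin n ⊕ Fin m) T),
          Hc.IsLocal (2 * k) ∧
          Hc.DegreeLE 2 ∧
          StoqGibbs.tvDist Hc.marginalGibbs (StoqGibbs.groundDistribution (∑ a, h a)) ≤ ε ∧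
          (T : ℝ) ≤ C * ((L : ℝ) ^ 3 * J * Δ⁻¹ *
            Real.log ((StoqGibbs.overlap (∑ a, h a))⁻¹ * ε⁻¹)) ∧
          (m : ℝ) ≤ C * ((k : ℝ) * (L : ℝ) ^ 3 * J * Δ⁻¹ *
            Real.log ((StoqGibbs.overlap (∑ a, h a))⁻¹ * ε⁻¹)) ∧
          ((∀ i : Fin n, ∃ a, StoqGibbs.ActsNontriviallyAt (h a) i) → ε ≤ 1 / 2 →
            ((n + m : ℕ) : ℝ) ≤ C * ((k : ℝ) * (L : ℝ) ^ 3 * J * Δ⁻¹ *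
              Real.log ((StoqGibbs.overlap (∑ a, h a))⁻¹ * ε⁻¹))) := by
  -- `40` from the rounds of gates, `4` from the `n ≤ kL` visible bits
  refine ⟨44, by norm_num, ?_⟩
  intro n k L h J Δ ε hloc hst hff hJ hΔ hgap hε0 hε1
  have hherm : ∀ a, (h a).IsHermitian := fun a => (hloc a).1
  have hη := overlap_pos (isHermitian_sum hherm) (stoquastic_sum hst)
  have hη1 := overlap_le_one (∑ a, h a)
  refine ⟨⟨hη, log_inv_overlap_le (isHermitian_sum hherm) (stoquastic_sum hst)⟩, ?_⟩
  set η := overlap (∑ a, h a) with hηdef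
  set ℓ := Real.log (η⁻¹ * ε⁻¹) with hℓ
  have hℓq : ℓ = Real.log (η * ε)⁻¹ := by rw [hℓ, mul_inv]
  have hlog2 : η * ε ≤ 1 / 2 → Real.log 2 ≤ ℓ := by
    intro hq
    rw [hℓq]
    apply Real.log_le_log two_pos
    rw [le_inv_comm₀ two_pos (by positivity)]
    linarith
  set Q := (L : ℝ) ^ 3 * J * Δ⁻¹ * ℓ with hQ
  have hkQ : (k : ℝ) * (L : ℝ) ^ 3 * J * Δ⁻¹ * ℓ = k * Q := by ring
  rw [hkQ]
  -- the visible bits fit into the budget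
  have hn : (∀ i : Fin n, ∃ a, ActsNontriviallyAt (h a) i) → ε ≤ 1 / 2 → (n : ℝ) ≤ 4 * (k * Q) := by
    intro hact hε2
    have hq : η * ε ≤ 1 / 2 := by nlinarith
    rcases Nat.eq_zero_or_pos n with h0 | h0
    · have hQ0 : 0 ≤ Q := by
        have : 0 ≤ (L : ℝ) ^ 3 * J := by
          rcases Nat.eq_zero_or_pos L with hL | hL
          · simp [hL]
          · have : 0 ≤ J := (norm_nonneg _).trans (hJ ⟨0, hL⟩)
            positivity
        have hℓ0 : 0 ≤ ℓ := (Real.log_pos one_lt_two).le.trans (hlog2 hq)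
        positivity
      rw [h0, Nat.cast_zero]
      positivity
    · obtain ⟨a, ha⟩ := hact ⟨0, h0⟩
      obtain ⟨hL, _, hb⟩ := pos_and_sq_le_budget hherm hJ hΔ hgap
        (groundSpace_ne_top_of_actsNontriviallyAt hff ha) (hlog2 hq)
      have h1 : (n : ℝ) ≤ L * k := by exact_mod_cast card_qubits_le hloc hact
      have hL1 : (1 : ℝ) ≤ L := Nat.one_le_cast.mpr hL
      calc (n : ℝ) ≤ L * k := h1
        _ ≤ (L : ℝ) ^ 2 * k := by gcongr; exact le_self_pow₀ hL1 two_ne_zero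
        _ ≤ 4 * Q * k := by gcongr
        _ = 4 * (k * Q) := by ring
  by_cases hcase : 1 - η ^ 2 ≤ ε ^ 2
  · -- the uniform distribution, with no terms and no hidden bits, is already close enough
    obtain ⟨m, T, Hc, hm, hT, h1, h2, h3⟩ :=
      (isPartitionFunction_one n k 2).exists_classicalHamiltonian
    obtain rfl : m = 0 := by omega
    obtain rfl : T = 0 := by omega
    have hQ0 : 0 ≤ Q := by
      have h4 : 0 ≤ (L : ℝ) ^ 3 * J := by
        rcases Nat.eq_zero_or_pos L with hL | hL
        · simp [hL]
        · have : 0 ≤ J := (norm_nonneg _).trans (hJ ⟨0, hL⟩)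
          positivity
      have hℓ0 : 0 ≤ ℓ := by
        rw [hℓq]
        apply Real.log_nonneg
        exact (one_le_inv₀ (by positivity)).mpr (by nlinarith)
      positivity
    refine ⟨0, 0, Hc, h1, h2, ?_, ?_, ?_, ?_⟩
    · have h4 : Hc.marginalGibbs = fun _ => (1 : ℝ) / 2 ^ n := by
        funext x
        rw [h3]
        simp
      rw [h4]
      refine (tvDist_uniform_le hη).trans ?_
      exact Real.sqrt_le_iff.mpr ⟨hε0.le, hcase⟩
    · rw [Nat.cast_zero]
      positivity
    · rw [Nat.cast_zero]
      positivity
    · intro hact hε2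
      have h5 : 0 ≤ (k : ℝ) * Q := by positivity
      rw [add_zero]
      linarith [hn hact hε2]
  · push Not at hcase
    have hq : η * ε ≤ 1 / 2 := by nlinarith [sq_nonneg (η - ε)]
    have hne : groundSpace (∑ a, h a) ≠ ⊤ := by
      intro htop
      rw [hηdef, overlap_eq_one_of_groundSpace_eq_top htop] at hcase
      nlinarith
    obtain ⟨hL, hJ0, hb⟩ := pos_and_sq_le_budget hherm hJ hΔ hgap hne (hlog2 hq)
    obtain ⟨M, hM, hMQ⟩ := exists_rounds hL hJ0 hΔ (mul_pos hη hε0) hℓq (hlog2 hq) hb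
    obtain ⟨f, hf, htv⟩ :=
      exists_isPartitionFunction_tvDist_le hloc hst hff hJ hJ0 hL hgap hε1 hM
    obtain ⟨m, T, Hc, hm, hT, h1, h2, h3⟩ := hf.exists_classicalHamiltonian
    have hQ0 : 0 ≤ Q := by nlinarith [sq_nonneg (L : ℝ)]
    have hT' : (T : ℝ) ≤ 2 * ((M : ℝ) * L) := by exact_mod_cast hT
    have hm' : (m : ℝ) ≤ 40 * (k * Q) := by
      calc (m : ℝ) ≤ 2 * (M * (L * k)) := by exact_mod_cast hm
        _ = 2 * ((M : ℝ) * L) * k := by ring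
        _ ≤ 40 * Q * k := by gcongr
        _ = 40 * (k * Q) := by ring
    have hkQ0 : 0 ≤ (k : ℝ) * Q := by positivity
    refine ⟨m, T, Hc, h1, h2, ?_, by linarith, by linarith, ?_⟩
    · rw [show Hc.marginalGibbs = _ from funext h3]
      exact htv
    · intro hact hε2
      push_cast
      linarith [hn hact hε2]
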